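/- Let $\tau=(x_1,\dots,x_N)$, $N\ge 1$, be a finite time series of strictly positive real numbers. *The graph.* The horizon visibility graph $\mathrm{HVG}_\infty(\tau)$ has vertices $0,1,\dots,N+1$; with $x_0=x_{N+1}=\infty$, vertices $i<j$ are adjacent iff $x_k<x_i$ and $x_k<x_j$ for all $i<k<j$. Let $\check\tau$ be the path with vertices $0,\dots,N$ whose edge $\{i-1,i\}$ has weight $x_i$, and let $T_{\check\tau}$ be its merge tree: its nodes are the distinct connected components $C$ of the sublevel graphs $\check\tau_a$, $a\ge 0$ (all vertices, and the edges of weight $\le a$), ordered by inclusion, the height of $C$ being the least $a\ge 0$ for which $C$ is a component of $\check\tau_a$. The edge above $C$ spans $[\alpha,\beta)$ with $\alpha$ the height of $C$ and $\beta$ that of its parent, and has length $\beta-\alpha$; the edge above the root has an arbitrary fixed length $r>0$. Draw $T_{\check\tau}$ in a disk with the leaves $0,\dots,N$ and the free end $\infty$ of the root edge on the circle, in this cyclic order, and let region $g\in\{0,\dots,N+1\}$ of the complement be the one that touches the circle between the leaves $g-1$ and $g$ (leaf $-1$ and leaf $N+1$ being read as $\infty$). The persistence weighted horizon visibility graph is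 $\mathrm{HVG}_\infty(\tau)$ in which each edge $\{i,j\}$ has as its weight the length of the edge of $T_{\check\tau}$ dual to it, i.e. of the tree edge shared by the boundaries of regions $i$ and $j$. *The pruned tree.* Let $T$ be the rooted tree dual to this weighted graph: its edges correspond to the edges $i<j$ of the graph, with the weights as lengths, each node being identified with the tree edge above it; $(i,j)$ is a descendant of $(i',j')$ iff $i'\le i<j\le j'$; and heights are measured from the leaves, which have height $0$. Let $T'$ be the first Horton pruning of $T$: delete all leaves with the edges above them, then suppress all vertices of degree two (nodes with exactly one child; the root also has an edge above it), keeping the heights of the remaining nodes. *The Elder Rule.* Choose any way (a strict total order) of breaking ties between leaves of equal height; a leaf is older than another if it is lower, or equally high and preferred by the tie-break. The Elder Rule assigns to each leaf $\ell$ of $T'$ the interval $[b,d)$, where $b$ is the height of $\ell$ and $d$ is the height of the lowest ancestor of $\ell$ below which there is a leaf older than $\ell$, with $d=\infty$ for the oldest leaf. **Proposition.** The multiset of intervals which the Elder Rule assigns to $T'$ is the $0$-dimensional persistence barcode of the piecewise linear interpolation $\mathrm{PL}_\tau:[1,N]\to\mathbb R$, $\mathrm{PL}_\tau(i)=x_i$.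 That is, all these intervals are non-empty, and for every field $k$ the persistence module $a\mapsto H_0(\{t\in[1,N]:\mathrm{PL}_\tau(t)\le a\};k)$, $a\in\mathbb R$, where $H_0$ is the free vector space on the connected components and the maps are induced by inclusion, is isomorphic to the direct sum of the interval modules of these intervals. -/

import Mathlib

noncomputable section

namespace HorizonTree

open CategoryTheory
open scoped Classical

/-! ### Horizontal and horizon visibility -/

/-- The horizontal visibility graph of a sequence `x`: two distinct indices are adjacent when every
value strictly between them is smaller than both of their values. -/
def horizontalVisibilityGraph {α : Type} [LinearOrder α] {m : ℕ} (x : Fin m → α) :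
    SimpleGraph (Fin m) where
  Adj i j := i ≠ j ∧ ∀ k, min i j < k → k < max i j → x k < x i ∧ x k < x j
  symm := ⟨fun i j h => ⟨h.1.symm, fun k h₁ h₂ =>
    (h.2 k (by rwa [min_comm]) (by rwa [max_comm])).symm⟩⟩
  loopless := ⟨fun _ h => h.1 rfl⟩

/-- The sequence `(∞, x₁, …, x_N, ∞)`. -/
def withHorizons {N : ℕ} (τ : Fin N → ℝ) : Fin (N + 2) → EReal :=
  Fin.cons ⊤ (Fin.snoc (α := fun _ => EReal) (fun i => (τ i : EReal)) ⊤)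

/-- The horizon visibility graph of a time series. -/
def horizonVisibilityGraph {N : ℕ} (τ : Fin N → ℝ) : SimpleGraph (Fin (N + 2)) :=
  horizontalVisibilityGraph (withHorizons τ)

/-! ### Weighted graphs, sublevel graphs and merge trees -/

/-- A graph with a weight on its edges (the values of `weight` off the edges play no role). -/
structure WeightedGraph (V : Type) where
  graph : SimpleGraph V
  weight : Sym2 V → ℝ

/-- The sublevel graph `G_a`: all the vertices, and the edges of weight at most `a`. -/
def WeightedGraph.sublevel {V : Type} (G : WeightedGraph V) (a : ℝ) : SimpleGraph V where
  Adj v w := G.graph.Adj v w ∧ G.weight s(v, w) ≤ a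
  symm := ⟨fun v w h => ⟨h.1.symm, by rw [Sym2.eq_swap]; exact h.2⟩⟩
  loopless := ⟨fun _ h => h.1.ne rfl⟩

/-- `C` is (the vertex set of) a connected component of the sublevel graph `G_a`. -/
def WeightedGraph.IsComponent {V : Type} (G : WeightedGraph V) (a : ℝ) (C : Set V) : Prop :=
  ∃ c : (G.sublevel a).ConnectedComponent, c.supp = C

/-- A finite rooted tree with heights. The tree is presented by its set of nodes inside a partial
order, where `v ≤ w` means that `v` is a descendant of `w`. -/
structure HeightTree (α : Type) where
  nodes : Set α
  height : α → ℝ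

/-- The merge tree of a graph with positive weights. Its nodes are the vertex sets of the connected
components of the sublevel graphs `G_a`, `a ≥ 0`, ordered by inclusion; the height of a node is the
threshold at which this component appears. -/
def WeightedGraph.mergeTree {V : Type} (G : WeightedGraph V) : HeightTree (Set V) where
  nodes := {C | ∃ a : ℝ, 0 ≤ a ∧ G.IsComponent a C}
  height C := sInf {a : ℝ | 0 ≤ a ∧ G.IsComponent a C}

/-- The length `β - α` of the edge above a node `v`, where `[α, β)` is the interval that this edge
spans: `α` is the height of `v` and `β` is the height of its parent. The edge above the root has the
prescribed length `r`. -/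
def HeightTree.edgeLength {α : Type} [PartialOrder α] (T : HeightTree α) (r : ℝ) (v : α) : ℝ :=
  if ∃ w ∈ T.nodes, v < w then sInf (T.height '' {w | w ∈ T.nodes ∧ v < w}) - T.height v else r

/-- The weighted path of a time series: vertices `0, …, N`, and an edge of weight `x_i` between
`i - 1` and `i`. -/
def weightedPath {N : ℕ} (τ : Fin N → ℝ) : WeightedGraph (Fin (N + 1)) where
  graph := SimpleGraph.pathGraph (N + 1)
  weight e := ∑ i : Fin N, if e = s(i.castSucc, i.succ) then τ i else 0

/-! ### Duality and persistence weights

Draw the merge tree of the weighted path of `τ` in a disk, with its leaves `0, …, N` and the free end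
`∞` of its root edge on the boundary circle, in this cyclic order. The complement of the tree has
`N + 2` regions: region `g` touches the circle between leaf `g - 1` and leaf `g`, where for `g = 0`
the former, and for `g = N + 1` the latter, is `∞`. -/

/-- The tree edge above the node with leaf set `C` lies on the boundary of region `g`. This boundary
consists of the tree path between the two ends of the circular arc of `g`, so the condition is that
exactly one of these two ends lies below the edge. -/
def OnBoundary {N : ℕ} (C : Set (Fin (N + 1))) (g : Fin (N + 2)) : Prop :=
  Xor (∃ v ∈ C, v.succ = g) (∃ v ∈ C, v.castSucc = g)

/-- The persistence weighted horizon visibility graph: the weight of the edge between `g` and `g'`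
is the length `β - α` of the merge tree edge dual to it, that is, of the tree edge shared by the
boundaries of the regions `g` and `g'` (two regions share at most one edge). The root edge of the
merge tree has length `r`. -/
def persistenceWeightedHVG {N : ℕ} (τ : Fin N → ℝ) (r : ℝ) : WeightedGraph (Fin (N + 2)) where
  graph := horizonVisibilityGraph τ
  weight e := ∑ C : Set (Fin (N + 1)) with
    C ∈ (weightedPath τ).mergeTree.nodes ∧ ∀ g ∈ e, OnBoundary C g,
    (weightedPath τ).mergeTree.edgeLength r C

/-! ### The tree dual to a weighted horizon visibility graph -/

/-- `v` is a leaf of the tree with node set `S`. -/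
def IsLeaf {α : Type} [PartialOrder α] (S : Set α) (v : α) : Prop :=
  Minimal (· ∈ S) v

/-- `c` is a child of `v` in the tree with node set `S`. -/
def IsChild {α : Type} [PartialOrder α] (S : Set α) (c v : α) : Prop :=
  c ∈ S ∧ v ∈ S ∧ c < v ∧ ∀ d ∈ S, c < d → ¬ d < v

/-- The height function of a rooted tree with node set `S` and edge lengths `len` (`len v` being the
length of the edge above `v`) all of whose leaves have height zero: the height of `v` is the length
of a descending path from `v` to a leaf. -/
def heightOfLengths {α : Type} [PartialOrder α] [Fintype α] (S : Set α) (len : α → ℝ) (v : α) : ℝ :=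
  ⨆ l : {l : α // IsLeaf S l ∧ l ≤ v}, ∑ w : α with w ∈ S ∧ l.1 ≤ w ∧ w < v, len w

/-- The rooted tree dual to a weighted graph such as the persistence weighted horizon visibility
graph, whose edges are drawn as non-crossing arcs over `0 < 1 < … < m - 1`. The tree edges correspond
to the edges `i < j` of the graph, and a node of the tree is identified with the tree edge above it;
the pair `(i, j)` is a descendant of `(i', j')` when `i' ≤ i` and `j ≤ j'`. The tree edge has the
length given by the weight of the edge of the graph, and the leaves have height zero. -/
def dualTree {m : ℕ} (G : WeightedGraph (Fin m)) : HeightTree ((Fin m)ᵒᵈ × Fin m) where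
  nodes := {p | OrderDual.ofDual p.1 < p.2 ∧ G.graph.Adj (OrderDual.ofDual p.1) p.2}
  height := heightOfLengths
    {p | OrderDual.ofDual p.1 < p.2 ∧ G.graph.Adj (OrderDual.ofDual p.1) p.2}
    (fun p => G.weight s(OrderDual.ofDual p.1, p.2))

/-! ### Horton pruning and the Elder Rule -/

/-- Cut off the leaves of a tree, together with their parental edges. -/
def cutLeaves {α : Type} [PartialOrder α] (S : Set α) : Set α :=
  {v ∈ S | ¬ IsLeaf S v}

/-- Remove the vertices of degree two of a rooted tree. As there is an edge above every node (the root
edge for the root), these are the nodes with exactly one child. -/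
def suppressDegreeTwo {α : Type} [PartialOrder α] (S : Set α) : Set α :=
  {v ∈ S | ¬ ∃! c, IsChild S c v}

/-- The first Horton pruning; the remaining nodes keep their heights. -/
def HeightTree.hortonPruning {α : Type} [PartialOrder α] (T : HeightTree α) : HeightTree α where
  nodes := suppressDegreeTwo (cutLeaves T.nodes)
  height := T.height

/-- `l'` is older than `l`: it is born earlier, or at the same height and `tie` prefers it. -/
def HeightTree.Older {α : Type} (T : HeightTree α) (tie : α → α → Prop) (l' l : α) : Prop :=
  T.height l' < T.height l ∨ T.height l' = T.height l ∧ tie l' l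

/-- The height at which the branch born at the leaf `l` dies: the height of the lowest ancestor of
`l` that has an older leaf among its descendants, and `∞` when `l` is the oldest leaf of the tree. -/
def HeightTree.death {α : Type} [PartialOrder α] (T : HeightTree α) (tie : α → α → Prop)
    (l : α) : EReal :=
  sInf {d : EReal | ∃ v ∈ T.nodes, l ≤ v ∧ (∃ l', IsLeaf T.nodes l' ∧ l' ≤ v ∧ T.Older tie l' l) ∧
    d = (T.height v : EReal)}

/-- The Elder Rule: one bar `[birth, death)` for each leaf of the tree. When branches merge, the
oldest of them survives and all the others die. -/
def HeightTree.elderRule {α : Type} [PartialOrder α] [Fintype α] (T : HeightTree α)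
    (tie : α → α → Prop) : Multiset (ℝ × EReal) :=
  (Finset.univ.filter (fun l : α => IsLeaf T.nodes l)).val.map
    (fun l => (T.height l, T.death tie l))

/-! ### Sublevel set persistent homology in degree zero -/

/-- Zeroth homology of the sublevel sets `{x | f x ≤ a}` with coefficients in `k`: the free vector
spaces on their connected components, with the maps induced by the inclusions. -/
def sublevelH0 (k : Type*) [Field k] {X : Type} [TopologicalSpace X] (f : X → ℝ) :
    ℝ ⥤ ModuleCat k where
  obj a := ModuleCat.of k (ConnectedComponents {x : X // f x ≤ a} →₀ k)
  map {a b} h := ModuleCat.ofHom (Finsupp.lmapDomain k k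
    (Continuous.connectedComponentsMap
      (f := fun x : {x : X // f x ≤ a} => (⟨x.1, x.2.trans (leOfHom h)⟩ : {x : X // f x ≤ b}))
      (by fun_prop)))
  map_id a := by
    apply ModuleCat.hom_ext
    rw [ModuleCat.hom_ofHom, ModuleCat.hom_id]
    refine Eq.trans ?_ (Finsupp.lmapDomain_id k k)
    congr 1
    funext c
    obtain ⟨x, rfl⟩ := ConnectedComponents.surjective_coe c
    rfl
  map_comp {a b c} h h' := by
    apply ModuleCat.hom_ext
    rw [ModuleCat.hom_ofHom, ModuleCat.hom_comp, ModuleCat.hom_ofHom, ModuleCat.hom_ofHom,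
      ← Finsupp.lmapDomain_comp]
    congr 1
    funext c
    obtain ⟨x, rfl⟩ := ConnectedComponents.surjective_coe c
    rfl

/-- The parameter `a` lies in the half open interval `[I.1, I.2)`. -/
def InBar (I : ℝ × EReal) (a : ℝ) : Prop :=
  I.1 ≤ a ∧ (a : EReal) < I.2

/-- The value at `a` of the direct sum of the interval modules of the intervals `I j`: a copy of `k`
for each interval that contains `a`. -/
def intervalSumObj (k : Type*) [Field k] {ι : Type} (I : ι → ℝ × EReal) (a : ℝ) :
    Submodule k (ι → k) where
  carrier := {c | ∀ j, ¬ InBar (I j) a → c j = 0}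
  add_mem' := fun {c d} hc hd j hj => by simp [hc j hj, hd j hj]
  zero_mem' := fun _ _ => rfl
  smul_mem' := fun s c hc j hj => by simp [hc j hj]

/-- The structure maps of a direct sum of interval modules: the identity on the copy of `k` belonging
to an interval that still contains `b`, and zero on the others. -/
def intervalSumMap (k : Type*) [Field k] {ι : Type} (I : ι → ℝ × EReal) (a b : ℝ) :
    intervalSumObj k I a →ₗ[k] intervalSumObj k I b where
  toFun c := ⟨fun j => if InBar (I j) b then c.1 j else 0, fun _ hj => if_neg hj⟩
  map_add' c d := by
    ext j
    by_cases hj : InBar (I j) b <;> simp [hj]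
  map_smul' s c := by
    ext j
    by_cases hj : InBar (I j) b <;> simp [hj]

/-- The direct sum of the interval modules of a finite family of intervals. -/
def intervalSum (k : Type*) [Field k] {ι : Type} [Finite ι] (I : ι → ℝ × EReal) :
    ℝ ⥤ ModuleCat k where
  obj a := ModuleCat.of k (intervalSumObj k I a)
  map {a b} _ := ModuleCat.ofHom (intervalSumMap k I a b)
  map_id a := by
    apply ModuleCat.hom_ext
    apply LinearMap.ext
    intro c
    apply Subtype.ext
    funext j
    change (if InBar (I j) a then c.1 j else 0) = c.1 j
    split_ifs with hj
    · rfl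
    · exact (c.2 j hj).symm
  map_comp {a b d} h h' := by
    apply ModuleCat.hom_ext
    apply LinearMap.ext
    intro c
    apply Subtype.ext
    funext j
    change (if InBar (I j) d then c.1 j else 0) =
      if InBar (I j) d then (if InBar (I j) b then c.1 j else 0) else 0
    by_cases hd : InBar (I j) d
    · by_cases hb : InBar (I j) b
      · simp [hd, hb]
      · have hc : c.1 j = 0 := c.2 j fun ha => hb
          ⟨ha.1.trans (leOfHom h), lt_of_le_of_lt (by exact_mod_cast leOfHom h') hd.2⟩
        simp [hc]
    · simp [hd]

/-- `B` is the barcode of the persistence module `M`: a finite multiset of nonempty intervals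
`[birth, death)` such that `M` is isomorphic to the direct sum of their interval modules. -/
def IsBarcode {k : Type*} [Field k] (M : ℝ ⥤ ModuleCat k) (B : Multiset (ℝ × EReal)) : Prop :=
  (∀ I ∈ B, (I.1 : EReal) < I.2) ∧
  ∃ (n : ℕ) (I : Fin n → ℝ × EReal), (Finset.univ : Finset (Fin n)).val.map I = B ∧
    Nonempty (M ≅ intervalSum k I)

/-! ### Piecewise linear interpolation -/

/-- The piecewise linear interpolation of the time series, taking the value `x_i` at time `i` for
`1 ≤ i ≤ N`, as a sum of hat functions on its domain `[1, N]`. -/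
def piecewiseLinear {N : ℕ} (τ : Fin N → ℝ) (t : Set.Icc (1 : ℝ) N) : ℝ :=
  ∑ i : Fin N, τ i * max 0 (1 - |t.1 - ((i : ℝ) + 1)|)

/-- Between consecutive sample times the interpolation is linear. -/
theorem piecewiseLinear_segment {N : ℕ} (τ : Fin N → ℝ) (t : Set.Icc (1 : ℝ) N) (i j : Fin N)
    (hij : (j : ℕ) = i + 1) (s : ℝ) (h₀ : 0 ≤ s) (h₁ : s ≤ 1) (ht : t.1 = (i : ℝ) + 1 + s) :
    piecewiseLinear τ t = (1 - s) * τ i + s * τ j := by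
  have hne : i ≠ j := fun h => by subst h; omega
  have hj : (j : ℝ) = i + 1 := by exact_mod_cast hij
  unfold piecewiseLinear
  rw [← Finset.sum_subset (Finset.subset_univ {i, j}), Finset.sum_pair hne]
  · rw [ht, hj, show (i : ℝ) + 1 + s - (i + 1) = s by ring,
      show (i : ℝ) + 1 + s - (i + 1 + 1) = -(1 - s) by ring, abs_neg, abs_of_nonneg h₀,
      abs_of_nonneg (sub_nonneg.2 h₁), max_eq_right (by linarith), max_eq_right (by linarith)]
    ring
  · intro l _ hl
    simp only [Finset.mem_insert, Finset.mem_singleton, not_or] at hl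
    have hl1 : (l : ℕ) ≠ i := fun h => hl.1 (Fin.ext h)
    have hl2 : (l : ℕ) ≠ j := fun h => hl.2 (Fin.ext h)
    rw [max_eq_left, mul_zero]
    rw [ht, sub_nonpos]
    rcases lt_or_gt_of_ne hl1 with h | h
    · have : (l : ℝ) + 1 ≤ i := by exact_mod_cast h
      rw [abs_of_nonneg (by linarith)]
      linarith
    · have h' : (i : ℕ) + 2 ≤ l := by omega
      have : (i : ℝ) + 2 ≤ l := by exact_mod_cast h'
      rw [abs_of_nonpos (by linarith)]
      linarith

end HorizonTree

end

noncomputable section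

namespace HorizonTree

open CategoryTheory
open scoped Classical

/-! ### Barcodes from a family of points with merge times -/

section Persistence

variable (k : Type*) [Field k] {X : Type} [TopologicalSpace X] (f : X → ℝ)

/-! Everything is controlled by one function on the visible pairs `i < j`: the largest value
strictly between the ends (`innerMax`). The pair `(i, j)` is visible exactly when, at this level,
the interval between `i` and `j` is a maximal run of values below or equal to the level. At a fixed
level such runs end at strictly larger values, so two that overlap coincide, and across levels they
are nested; this laminarity makes the visible pairs a tree.

The merge tree is the same tree: components of the sublevel path are the leaf sets `segment p`, with
height `innerMax p`, and the tree edge above `segment p` is the one shared by the regions `lo p` and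
`hi p`. Its length is the difference between the parent's `innerMax` and that of `p`, so path sums
telescope and the dual tree has height `innerMax` (`dualTree_height`). Its leaves are the pairs `(i,
i + 1)`. Cutting them keeps the pairs that contain a sample, which correspond to the components of
the sublevel sets of the interpolation; the new leaves are the plateaus at local minima. Suppressing
vertices of degree two affects neither the leaves nor the lowest common ancestors of distinct
leaves. Hence samples in two leaves are connected at level `a` iff the leaves have a common ancestor
of height at most `a` (`sameComponent_leafTime_iff`).

The rest is linear algebra, stated abstractly through `ElderData`. To each leaf belongs the class of
its point minus the class of an older point into which it merges at death (or minus nothing if it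
never dies). This class vanishes from the death on, and the classes alive at `a` form a basis of
`H₀`, being triangular with respect to age. -/

/-- The class in `H₀` of the sublevel set at `a` of a point, and zero before the point appears. -/
def pointClass (x : X) (a : ℝ) : ConnectedComponents {x : X // f x ≤ a} →₀ k :=
  if h : f x ≤ a then Finsupp.single (ConnectedComponents.mk ⟨x, h⟩) 1 else 0

theorem pointClass_of_le {x : X} {a : ℝ} (h : f x ≤ a) :
    pointClass k f x a = Finsupp.single (ConnectedComponents.mk ⟨x, h⟩) 1 := dif_pos h

/-- The structure maps of the persistence module `sublevelH0 k f`. -/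
def sublevelMap {a b : ℝ} (hab : a ⟶ b) : (ConnectedComponents {x : X // f x ≤ a} →₀ k) →ₗ[k]
    (ConnectedComponents {x : X // f x ≤ b} →₀ k) :=
  ((sublevelH0 k f).map hab).hom

theorem sublevelMap_pointClass {x : X} {a b : ℝ} (h : f x ≤ a) (hab : a ⟶ b) :
    sublevelMap k f hab (pointClass k f x a) = pointClass k f x b := by
  rw [pointClass_of_le k f h, pointClass_of_le k f (h.trans (leOfHom hab))]
  exact Finsupp.mapDomain_single

/-- Two points that appear by time `a` lie in the same component of the sublevel set. -/
def SameComponent (x y : X) (a : ℝ) : Prop :=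
  ∃ (hx : f x ≤ a) (hy : f y ≤ a),
    (ConnectedComponents.mk (⟨x, hx⟩ : {x : X // f x ≤ a})) = ConnectedComponents.mk ⟨y, hy⟩

/-- Data exhibiting intervals as an elder rule: `pt l` is a point born at `(I l).1`, and it is
merged into the component of some older point precisely from the time `(I l).2` on. -/
structure ElderData {ι : Type} (older : ι → ι → Prop) (pt : ι → X) (I : ι → ℝ × EReal) : Prop where
  birth : ∀ l, (I l).1 = f (pt l)
  mono : ∀ l l', older l' l → f (pt l') ≤ f (pt l)
  cover : ∀ a x, f x ≤ a → ∃ l, SameComponent f x (pt l) a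
  alive : ∀ l l' (a : ℝ), older l' l → (a : EReal) < (I l).2 → ¬ SameComponent f (pt l) (pt l') a
  merge : ∀ l, (I l).2 ≠ ⊤ → ∃ l', older l' l ∧ ∀ a : ℝ, (I l).2 ≤ a →
    SameComponent f (pt l) (pt l') a
  lt : ∀ l, ((I l).1 : EReal) < (I l).2

variable {k f}

theorem SameComponent.pointClass_eq {x y : X} {a : ℝ} (h : SameComponent f x y a) :
    pointClass k f x a = pointClass k f y a := by
  obtain ⟨hx, hy, h⟩ := h
  rw [pointClass_of_le k f hx, pointClass_of_le k f hy, h]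

variable {ι : Type} {older : ι → ι → Prop} {pt : ι → X} {I : ι → ℝ × EReal}

/-- An older point into whose component the point of index `l` is merged at its death. -/
def ElderData.elder (E : ElderData f older pt I) (l : ι) : ι :=
  if h : (I l).2 ≠ ⊤ then (E.merge l h).choose else l

theorem ElderData.elder_older (E : ElderData f older pt I) {l : ι} (h : (I l).2 ≠ ⊤) :
    older (E.elder l) l := by
  rw [ElderData.elder, dif_pos h]
  exact (E.merge l h).choose_spec.1

theorem ElderData.elder_sameComponent (E : ElderData f older pt I) {l : ι} {a : ℝ}
    (h : (I l).2 ≤ a) : SameComponent f (pt l) (pt (E.elder l)) a := by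
  have h' : (I l).2 ≠ ⊤ := (h.trans_lt (EReal.coe_lt_top a)).ne
  rw [ElderData.elder, dif_pos h']
  exact (E.merge l h').choose_spec.2 a h

variable (k) in
/-- The difference of the class of a point and the class of its elder. -/
def ElderData.barClass (E : ElderData f older pt I) (l : ι) (a : ℝ) :
    ConnectedComponents {x : X // f x ≤ a} →₀ k :=
  pointClass k f (pt l) a - if (I l).2 = ⊤ then 0 else pointClass k f (pt (E.elder l)) a

theorem ElderData.barClass_eq_zero (E : ElderData f older pt I) {l : ι} {a : ℝ}
    (h : (I l).2 ≤ a) : E.barClass k l a = 0 := by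
  have h' : (I l).2 ≠ ⊤ := (h.trans_lt (EReal.coe_lt_top a)).ne
  rw [ElderData.barClass, if_neg h', (E.elder_sameComponent h).pointClass_eq, sub_self]

theorem ElderData.sublevelMap_barClass (E : ElderData f older pt I) {l : ι} {a b : ℝ}
    (h : f (pt l) ≤ a) (hab : a ⟶ b) :
    sublevelMap k f hab (E.barClass k l a) = E.barClass k l b := by
  unfold ElderData.barClass
  rw [map_sub, sublevelMap_pointClass k f h]
  split_ifs with h'
  · rw [map_zero]
  · rw [sublevelMap_pointClass k f ((E.mono _ _ (E.elder_older h')).trans h)]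

/-- Source of the triangularity: while `l` is alive, its component contains no older point. -/
theorem ElderData.pointClass_apply_eq_zero (E : ElderData f older pt I) {l l' : ι} {a : ℝ}
    (hl : f (pt l) ≤ a) (ha : a < (I l).2) (ho : older l' l) :
    pointClass k f (pt l') a (ConnectedComponents.mk ⟨pt l, hl⟩) = 0 := by
  have h' := (E.mono _ _ ho).trans hl
  rw [pointClass_of_le k f h']
  exact Finsupp.single_eq_of_ne fun h => E.alive l l' a ho ha ⟨hl, h', h⟩

variable [Fintype ι]

variable (k) in
/-- The map from the sum of interval modules to `H₀` at time `a`. -/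
def ElderData.toH0 (E : ElderData f older pt I) (a : ℝ) :
    intervalSumObj k I a →ₗ[k] (ConnectedComponents {x : X // f x ≤ a} →₀ k) where
  toFun c := ∑ l, c.1 l • E.barClass k l a
  map_add' c d := by simp [add_smul, Finset.sum_add_distrib]
  map_smul' s c := by simp [mul_smul, Finset.smul_sum]

/-- The coefficients that the interval modules forget on the way to `b` belong to bars that are dead
by then, and their classes have become zero. -/
theorem ElderData.toH0_naturality (E : ElderData f older pt I) {a b : ℝ} (hab : a ⟶ b)
    (c : intervalSumObj k I a) :
    E.toH0 k b (intervalSumMap k I a b c) = sublevelMap k f hab (E.toH0 k a c) := by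
  refine Eq.trans ?_ (map_sum _ (fun l => c.1 l • E.barClass k l a) Finset.univ).symm
  refine Finset.sum_congr rfl fun l _ => ?_
  rw [map_smul]
  change (if InBar (I l) b then c.1 l else 0) • _ = _
  by_cases ha : InBar (I l) a
  · rw [E.sublevelMap_barClass (E.birth l ▸ ha.1)]
    split_ifs with hb
    · rfl
    · have : (I l).2 ≤ b := not_lt.1 fun h => hb ⟨ha.1.trans (leOfHom hab), h⟩
      rw [E.barClass_eq_zero this, smul_zero, smul_zero]
  · simp only [c.2 l ha, ite_self, zero_smul]

theorem ElderData.single_mem_range (E : ElderData f older pt I) {l : ι} {a : ℝ} (h : InBar (I l) a) :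
    E.barClass k l a ∈ LinearMap.range (E.toH0 k a) := by
  refine ⟨⟨Pi.single l 1, fun j hj => Pi.single_eq_of_ne (by rintro rfl; exact hj h) _⟩, ?_⟩
  change ∑ j, (Pi.single l 1 : ι → k) j • E.barClass k j a = _
  rw [Finset.sum_eq_single l (fun j _ hj => by rw [Pi.single_eq_of_ne hj, zero_smul]) (by simp)]
  simp

/-- Induction on age. A dead point has the class of its elder; a living one differs from its elder
by its own bar class, or equals that bar class if it is immortal. -/
theorem ElderData.pointClass_mem_range [IsStrictTotalOrder ι older] (E : ElderData f older pt I)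
    (a : ℝ) (l : ι) (h : f (pt l) ≤ a) :
    pointClass k f (pt l) a ∈ LinearMap.range (E.toH0 k a) := by
  induction l using (Finite.wellFounded_of_trans_of_irrefl older).induction with
  | _ l ih =>
    by_cases hd : (I l).2 ≤ a
    · have hs := E.elder_sameComponent hd
      rw [hs.pointClass_eq]
      exact ih _ (E.elder_older (hd.trans_lt (EReal.coe_lt_top a)).ne) hs.2.choose
    · have hb := E.single_mem_range (k := k) (l := l) (a := a)
        ⟨(E.birth l).trans_le h, not_le.1 hd⟩
      unfold ElderData.barClass at hb
      split_ifs at hb with ht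
      · simpa using hb
      · have ho := E.elder_older ht
        simpa using add_mem hb (ih _ ho ((E.mono _ _ ho).trans h))

theorem ElderData.toH0_surjective [IsStrictTotalOrder ι older] (E : ElderData f older pt I)
    (a : ℝ) : Function.Surjective (E.toH0 k a) := by
  rw [← LinearMap.range_eq_top, eq_top_iff]
  rintro z -
  induction z using Finsupp.induction_linear with
  | zero => exact zero_mem _
  | add y z hy hz => exact add_mem hy hz
  | single C s =>
    obtain ⟨⟨x, hx⟩, rfl⟩ := ConnectedComponents.surjective_coe C
    obtain ⟨l, hl⟩ := E.cover a x hx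
    have := Submodule.smul_mem _ s (E.pointClass_mem_range (k := k) a l hl.2.choose)
    rwa [← hl.pointClass_eq, pointClass_of_le k f hx, Finsupp.smul_single, smul_eq_mul,
      mul_one] at this

/-- In a vanishing combination, take the youngest index with nonzero coefficient and evaluate at the
component of its point. All other points involved are older, so only its own coefficient survives.
-/
theorem ElderData.toH0_injective [IsStrictTotalOrder ι older] (E : ElderData f older pt I)
    (a : ℝ) : Function.Injective (E.toH0 k a) := by
  rw [← LinearMap.ker_eq_bot, LinearMap.ker_eq_bot']
  intro c hc
  by_contra hne
  have hex : ∃ l, c.1 l ≠ 0 := by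
    by_contra! h
    exact hne (Subtype.ext (funext h))
  obtain ⟨l, hl, hmax⟩ := (Finite.wellFounded_of_trans_of_irrefl (Function.swap older)).has_min
    {l | c.1 l ≠ 0} hex
  have hbar : ∀ l, c.1 l ≠ 0 → InBar (I l) a := fun l h => not_not.1 (mt (c.2 l) h)
  have hb := hbar l hl
  have hla : f (pt l) ≤ a := E.birth l ▸ hb.1
  have hzero : ∀ l', l' = l ∨ older l' l →
      (if (I l').2 = ⊤ then 0 else pointClass k f (pt (E.elder l')) a)
        (ConnectedComponents.mk ⟨pt l, hla⟩) = 0 := by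
    intro l' h
    split_ifs with ht
    · rfl
    · refine E.pointClass_apply_eq_zero hla hb.2 ?_
      rcases h with rfl | h
      · exact E.elder_older ht
      · exact _root_.trans (E.elder_older ht) h
  have := DFunLike.congr_fun hc (ConnectedComponents.mk ⟨pt l, hla⟩)
  change (∑ l, c.1 l • E.barClass k l a) _ = 0 at this
  rw [Finsupp.finsetSum_apply, Finset.sum_eq_single l] at this
  · rw [ElderData.barClass, Finsupp.smul_apply, Finsupp.sub_apply, hzero l (Or.inl rfl),
      pointClass_of_le k f hla, Finsupp.single_eq_same] at this
    exact hl (by simpa using this)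
  · intro l' _ hne'
    by_cases hl' : c.1 l' = 0
    · rw [hl', zero_smul]; rfl
    · have ho : older l' l := by
        rcases trichotomous_of older l' l with h | h | h
        · exact h
        · exact absurd h hne'
        · exact absurd h (hmax l' hl')
      rw [ElderData.barClass, Finsupp.smul_apply, Finsupp.sub_apply, hzero l' (Or.inr ho),
        E.pointClass_apply_eq_zero hla hb.2 ho, sub_zero, smul_zero]
  · simp

theorem ElderData.nonempty_iso [IsStrictTotalOrder ι older] (E : ElderData f older pt I) :
    Nonempty (sublevelH0 k f ≅ intervalSum k I) :=
  ⟨(NatIso.ofComponents (fun a => (LinearEquiv.ofBijective (E.toH0 k a)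
    ⟨E.toH0_injective a, E.toH0_surjective a⟩).toModuleIso) fun {a b} hab => by
      apply ModuleCat.hom_ext
      apply LinearMap.ext
      intro c
      exact E.toH0_naturality hab c).symm⟩

theorem ElderData.isBarcode [IsStrictTotalOrder ι older] (E : ElderData f older pt I) :
    IsBarcode (sublevelH0 k f) (Finset.univ.val.map I) := by
  refine ⟨fun J hJ => ?_, ?_⟩
  · obtain ⟨l, _, rfl⟩ := Multiset.mem_map.1 hJ
    exact E.lt l
  · let e := (Fintype.equivFin ι).symm
    refine ⟨Fintype.card ι, I ∘ e, ?_, ?_⟩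
    · rw [← Multiset.map_map]
      congr 1
      exact congrArg Finset.val (Finset.map_univ_equiv e)
    · have : IsStrictTotalOrder _ (Order.Preimage e older) :=
        (RelEmbedding.preimage e.toEmbedding older).isStrictTotalOrder
      have E' : ElderData f (Order.Preimage e older) (pt ∘ e) (I ∘ e) :=
        { birth := fun l => E.birth _
          mono := fun l l' => E.mono _ _
          cover := fun a x hx => (E.cover a x hx).imp' e.symm fun l hl => by simpa using hl
          alive := fun l l' a => E.alive _ _ a
          merge := fun l hl => (E.merge _ hl).imp' e.symm fun l' hl' => by
            simpa [Order.Preimage] using hl'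
          lt := fun l => E.lt _ }
      exact E'.nonempty_iso

end Persistence

/-! ### Components of the sublevel sets of a piecewise linear interpolation -/

theorem SameComponent.symm {X : Type} [TopologicalSpace X] {f : X → ℝ} {x y : X} {a : ℝ}
    (h : SameComponent f x y a) : SameComponent f y x a :=
  ⟨h.2.choose, h.choose, h.2.choose_spec.symm⟩

theorem SameComponent.trans {X : Type} [TopologicalSpace X] {f : X → ℝ} {x y z : X} {a : ℝ}
    (h : SameComponent f x y a) (h' : SameComponent f y z a) : SameComponent f x z a :=
  ⟨h.choose, h'.2.choose, h.2.choose_spec.trans h'.2.choose_spec⟩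

section PiecewiseLinear

variable {N : ℕ} {τ : Fin N → ℝ}

theorem sameComponent_of_le_on_interval {f : Set.Icc (1 : ℝ) N → ℝ} {s t : Set.Icc (1 : ℝ) N}
    {a : ℝ} (hst : s ≤ t) (h : ∀ u, s ≤ u → u ≤ t → f u ≤ a) : SameComponent f s t a := by
  let g : Set.Icc s.1 t.1 → {x // f x ≤ a} := fun u =>
    ⟨⟨u.1, s.2.1.trans u.2.1, u.2.2.trans t.2.2⟩, h _ u.2.1 u.2.2⟩
  have hg : Continuous g := by fun_prop
  have : PreconnectedSpace (Set.Icc s.1 t.1) := Subtype.preconnectedSpace isPreconnected_Icc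
  refine ⟨h s le_rfl hst, h t hst le_rfl, ConnectedComponents.coe_eq_coe'.2 ?_⟩
  exact (isPreconnected_range hg).subset_connectedComponent
    ⟨⟨t.1, hst, le_rfl⟩, rfl⟩ ⟨⟨s.1, le_rfl, hst⟩, rfl⟩

/-- The time `i + 1` of the value `τ i`. -/
def sampleTime (i : Fin N) : Set.Icc (1 : ℝ) N :=
  ⟨(i : ℝ) + 1, by simp, by exact_mod_cast i.2⟩

theorem piecewiseLinear_sampleTime (i : Fin N) : piecewiseLinear τ (sampleTime i) = τ i := by
  unfold piecewiseLinear
  rw [Finset.sum_eq_single i]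
  · simp [sampleTime]
  · intro j _ hj
    rw [max_eq_left, mul_zero]
    have h : (i : ℤ) - j ≠ 0 := sub_ne_zero.2 fun h => hj (Fin.ext (by exact_mod_cast h.symm))
    have : (1 : ℝ) ≤ |(i : ℝ) - j| := by exact_mod_cast Int.one_le_abs h
    simpa [sampleTime] using this
  · simp

theorem sameComponent_sampleTime_succ {i j : Fin N} (hij : (j : ℕ) = i + 1) {a : ℝ}
    (hi : τ i ≤ a) (hj : τ j ≤ a) :
    SameComponent (piecewiseLinear τ) (sampleTime i) (sampleTime j) a := by
  have hj' : (j : ℝ) = i + 1 := by exact_mod_cast hij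
  refine sameComponent_of_le_on_interval ?_ fun u h₁ h₂ => ?_
  · change (i : ℝ) + 1 ≤ (j : ℝ) + 1
    linarith
  · have h₁ : (i : ℝ) + 1 ≤ u.1 := h₁
    have h₂ : u.1 ≤ (j : ℝ) + 1 := h₂
    rw [piecewiseLinear_segment τ u i j hij (u.1 - (i + 1)) (by linarith) (by linarith) (by ring)]
    nlinarith

/-- A connected subset of the line that contains two times contains all times in between, so no
sample in between may exceed `a`. Conversely, consecutive samples are joined by segments. -/
theorem sameComponent_sampleTime_iff {i j : Fin N} (hij : i ≤ j) {a : ℝ} :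
    SameComponent (piecewiseLinear τ) (sampleTime i) (sampleTime j) a ↔
      ∀ l, i ≤ l → l ≤ j → τ l ≤ a := by
  constructor
  · rintro ⟨hi, hj, h⟩ l h₁ h₂
    have hc := ConnectedComponents.coe_eq_coe'.1 h
    have hi' := mem_connectedComponent (x := (⟨sampleTime j, hj⟩ : {x // piecewiseLinear τ x ≤ a}))
    have hp := (isPreconnected_connectedComponent (x :=
      (⟨sampleTime j, hj⟩ : {x // piecewiseLinear τ x ≤ a}))).image
      (fun x => (x.1.1 : ℝ)) (by fun_prop)
    obtain ⟨⟨x, hx⟩, -, hxl⟩ := hp.Icc_subset ⟨_, hc, rfl⟩ ⟨_, hi', rfl⟩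
      (show (l : ℝ) + 1 ∈ Set.Icc ((i : ℝ) + 1) ((j : ℝ) + 1) from
        ⟨by gcongr; exact_mod_cast h₁, by gcongr; exact_mod_cast h₂⟩)
    have : x = sampleTime l := Subtype.ext hxl
    rwa [this, piecewiseLinear_sampleTime] at hx
  · intro h
    obtain ⟨n, hn⟩ : ∃ n : ℕ, (j : ℕ) = i + n := ⟨j - i, by have : (i : ℕ) ≤ j := hij; omega⟩
    induction n generalizing j with
    | zero =>
      obtain rfl : j = i := Fin.ext hn
      have := (piecewiseLinear_sampleTime (τ := τ) j).trans_le (h j le_rfl le_rfl)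
      exact ⟨this, this, rfl⟩
    | succ n ih =>
      have hj := j.2
      let m : Fin N := ⟨i + n, by omega⟩
      have him : i ≤ m := Fin.le_def.2 (by simp [m])
      have hmj : m ≤ j := Fin.le_def.2 (by simp [m]; omega)
      exact (ih him (fun l h₁ h₂ => h l h₁ (h₂.trans hmj)) rfl).trans
        (sameComponent_sampleTime_succ (by simp [m]; omega) (h m him hmj) (h j hij le_rfl))

/-- Walk from `t` to the lower end of its linear piece, along which the function does not increase.
The last time `N` starts no piece but is itself a sample. -/
theorem exists_sameComponent_sampleTime {t : Set.Icc (1 : ℝ) N} {a : ℝ}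
    (ht : piecewiseLinear τ t ≤ a) :
    ∃ i, SameComponent (piecewiseLinear τ) t (sampleTime i) a := by
  have h0 : 1 ≤ ⌊t.1⌋₊ := Nat.le_floor (by simpa using t.2.1)
  have h1 : (⌊t.1⌋₊ : ℝ) ≤ t.1 := Nat.floor_le (by linarith [t.2.1])
  have h2 : t.1 < ⌊t.1⌋₊ + 1 := Nat.lt_floor_add_one t.1
  have hN : ⌊t.1⌋₊ ≤ N := by exact_mod_cast h1.trans t.2.2
  let i : Fin N := ⟨⌊t.1⌋₊ - 1, by omega⟩
  have hi : (i : ℝ) + 1 = ⌊t.1⌋₊ := by exact_mod_cast Nat.sub_add_cancel h0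
  rcases hN.lt_or_eq with hlt | heq
  · let j : Fin N := ⟨⌊t.1⌋₊, hlt⟩
    have hij : (j : ℕ) = i + 1 := by simp [i, j]; omega
    have hj : (j : ℝ) = i + 1 := hi.symm
    have key := piecewiseLinear_segment τ t i j hij (t.1 - (i + 1)) (by linarith) (by linarith)
      (by ring)
    rcases le_total (τ i) (τ j) with hle | hle
    · refine ⟨i, (sameComponent_of_le_on_interval (f := piecewiseLinear τ) (s := sampleTime i)
        (t := t) (show (i : ℝ) + 1 ≤ t.1 by linarith) fun u h₁ h₂ => ?_).symm⟩
      have h₁ : (i : ℝ) + 1 ≤ u.1 := h₁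
      have h₂ : u.1 ≤ t.1 := h₂
      rw [piecewiseLinear_segment τ u i j hij (u.1 - (i + 1)) (by linarith) (by linarith) (by ring)]
      nlinarith
    · refine ⟨j, sameComponent_of_le_on_interval (f := piecewiseLinear τ) (s := t)
        (t := sampleTime j) (show t.1 ≤ (j : ℝ) + 1 by linarith) fun u h₁ h₂ => ?_⟩
      have h₁ : t.1 ≤ u.1 := h₁
      have h₂ : u.1 ≤ (j : ℝ) + 1 := h₂
      rw [piecewiseLinear_segment τ u i j hij (u.1 - (i + 1)) (by linarith) (by linarith) (by ring)]
      nlinarith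
  · have : t = sampleTime i := Subtype.ext (by
      change t.1 = (i : ℝ) + 1
      have := t.2.2
      rw [hi, heq]
      rw [heq] at h1
      linarith)
    exact ⟨i, by rw [← this]; exact ⟨ht, ht, rfl⟩⟩

end PiecewiseLinear

/-! ### Visible pairs and their levels -/

section VisiblePairs

variable {N : ℕ}

/-- Pairs of indices, ordered by inclusion of the intervals that they span. -/
abbrev IndexPair (N : ℕ) := (Fin (N + 2))ᵒᵈ × Fin (N + 2)

/-- The left end of a pair. -/
abbrev IndexPair.lo (p : IndexPair N) : Fin (N + 2) := OrderDual.ofDual p.1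

/-- The right end of a pair. -/
abbrev IndexPair.hi (p : IndexPair N) : Fin (N + 2) := p.2

open IndexPair

/-- The pair with given ends. -/
abbrev indexPair (i j : Fin (N + 2)) : IndexPair N := (OrderDual.toDual i, j)

theorem lo_indexPair (i j : Fin (N + 2)) : lo (indexPair i j) = i := rfl

theorem hi_indexPair (i j : Fin (N + 2)) : hi (indexPair i j) = j := rfl

theorem IndexPair.le_iff {p q : IndexPair N} : p ≤ q ↔ lo q ≤ lo p ∧ hi p ≤ hi q := Iff.rfl

theorem IndexPair.lt_iff {p q : IndexPair N} :
    p < q ↔ p ≤ q ∧ (lo q < lo p ∨ hi p < hi q) := by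
  rw [lt_iff_le_not_ge, le_iff, le_iff, not_and_or, not_le, not_le]

variable (τ : Fin N → ℝ)

/-- The edges of the horizon visibility graph. -/
def visiblePairs : Set (IndexPair N) :=
  {p | lo p < hi p ∧ (horizonVisibilityGraph τ).Adj (lo p) (hi p)}

/-- The largest value strictly between the ends of a pair, or zero if there is none. -/
def innerMax (p : IndexPair N) : ℝ :=
  ⨆ l : Fin N, if lo p < l.castSucc.succ ∧ l.castSucc.succ < hi p then τ l else 0

/-- The pair spans a maximal interval on which the values are at most `a`. -/
structure IsLevelPair (a : ℝ) (p : IndexPair N) : Prop where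
  lt : lo p < hi p
  left : a < withHorizons τ (lo p)
  right : a < withHorizons τ (hi p)
  inner : ∀ m, lo p < m → m < hi p → withHorizons τ m ≤ a

variable {τ}

theorem withHorizons_last : withHorizons τ (Fin.last (N + 1)) = ⊤ := by
  rw [← Fin.succ_last]
  simp [withHorizons]

theorem withHorizons_castSucc_succ (l : Fin N) : withHorizons τ l.castSucc.succ = τ l := by
  simp [withHorizons]

theorem exists_eq_castSucc_succ {i j m : Fin (N + 2)} (h : i < m) (h' : m < j) :
    ∃ l : Fin N, m = l.castSucc.succ := by
  have := j.2
  rw [Fin.lt_def] at h h'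
  exact ⟨⟨m - 1, by omega⟩, Fin.ext (by simp; omega)⟩

theorem withHorizons_pos (hτ : ∀ i, 0 < τ i) (m : Fin (N + 2)) : 0 < withHorizons τ m := by
  rcases eq_or_ne m 0 with rfl | h0
  · exact EReal.zero_lt_top
  · rcases eq_or_ne m (Fin.last _) with rfl | h1
    · rw [withHorizons_last]; exact EReal.zero_lt_top
    · obtain ⟨l, rfl⟩ := exists_eq_castSucc_succ (Fin.pos_iff_ne_zero.2 h0) (Fin.lt_last_iff_ne_last.2 h1)
      rw [withHorizons_castSucc_succ]
      exact_mod_cast hτ l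

theorem mem_visiblePairs {p : IndexPair N} : p ∈ visiblePairs τ ↔ lo p < hi p ∧
    ∀ m, lo p < m → m < hi p →
      withHorizons τ m < withHorizons τ (lo p) ∧ withHorizons τ m < withHorizons τ (hi p) := by
  refine and_congr_right fun h => ?_
  change _ ≠ _ ∧ (∀ m, min (lo p) (hi p) < m → m < max (lo p) (hi p) → _) ↔ _
  rw [min_eq_left h.le, max_eq_right h.le]
  exact and_iff_right h.ne

/-- Nonnegativity of `a` absorbs the default value zero of `innerMax`. -/
theorem innerMax_le_iff {p : IndexPair N} {a : ℝ} (ha : 0 ≤ a) :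
    innerMax τ p ≤ a ↔ ∀ m, lo p < m → m < hi p → withHorizons τ m ≤ a := by
  constructor
  · intro h m h₁ h₂
    obtain ⟨l, rfl⟩ := exists_eq_castSucc_succ h₁ h₂
    rw [withHorizons_castSucc_succ, EReal.coe_le_coe_iff]
    refine le_trans ?_ ((le_ciSup (Set.finite_range _).bddAbove l).trans h)
    rw [if_pos ⟨h₁, h₂⟩]
  · intro h
    refine Real.iSup_le (fun l => ?_) ha
    split_ifs with hl
    · have := h _ hl.1 hl.2
      rwa [withHorizons_castSucc_succ, EReal.coe_le_coe_iff] at this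
    · exact ha

theorem innerMax_nonneg (hτ : ∀ i, 0 < τ i) (p : IndexPair N) : 0 ≤ innerMax τ p := by
  refine Real.iSup_nonneg fun l => ?_
  split_ifs
  · exact (hτ l).le
  · exact le_rfl

theorem le_innerMax (hτ : ∀ i, 0 < τ i) {p : IndexPair N} {m : Fin (N + 2)} (h₁ : lo p < m)
    (h₂ : m < hi p) : withHorizons τ m ≤ innerMax τ p :=
  (innerMax_le_iff (innerMax_nonneg hτ p)).1 le_rfl m h₁ h₂

theorem innerMax_lt {p : IndexPair N} {y : EReal} (hy : 0 < y)
    (h : ∀ m, lo p < m → m < hi p → withHorizons τ m < y) : innerMax τ p < y := by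
  rcases isEmpty_or_nonempty (Fin N) with _ | _
  · rw [innerMax, Real.iSup_of_isEmpty]
    exact hy
  · obtain ⟨l, hl⟩ := exists_eq_ciSup_of_finite
      (f := fun l : Fin N => if lo p < l.castSucc.succ ∧ l.castSucc.succ < hi p then τ l else 0)
    rw [innerMax, ← hl]
    split_ifs with hl'
    · rw [← withHorizons_castSucc_succ]
      exact h _ hl'.1 hl'.2
    · exact hy

theorem isLevelPair_innerMax (hτ : ∀ i, 0 < τ i) {p : IndexPair N} (hp : p ∈ visiblePairs τ) :
    IsLevelPair τ (innerMax τ p) p := by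
  rw [mem_visiblePairs] at hp
  exact ⟨hp.1, innerMax_lt (withHorizons_pos hτ _) fun m h₁ h₂ => (hp.2 m h₁ h₂).1,
    innerMax_lt (withHorizons_pos hτ _) fun m h₁ h₂ => (hp.2 m h₁ h₂).2,
    fun m h₁ h₂ => le_innerMax hτ h₁ h₂⟩

theorem IsLevelPair.mem_visiblePairs {p : IndexPair N} {a : ℝ} (h : IsLevelPair τ a p) :
    p ∈ visiblePairs τ :=
  HorizonTree.mem_visiblePairs.2 ⟨h.lt, fun m h₁ h₂ =>
    ⟨(h.inner m h₁ h₂).trans_lt h.left, (h.inner m h₁ h₂).trans_lt h.right⟩⟩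

theorem IsLevelPair.innerMax_le {p : IndexPair N} {a : ℝ} (h : IsLevelPair τ a p) (ha : 0 ≤ a) :
    innerMax τ p ≤ a :=
  (innerMax_le_iff ha).2 h.inner

/-- Every interval on which the values are at most `a` extends to a maximal one. -/
theorem exists_isLevelPair {q : IndexPair N} {a : ℝ} (hq : lo q < hi q)
    (h : ∀ m, lo q < m → m < hi q → withHorizons τ m ≤ a) :
    ∃ p, q ≤ p ∧ IsLevelPair τ a p := by
  obtain ⟨i, ⟨hi₁, hi₂⟩, hi₃⟩ := (wellFounded_gt (α := Fin (N + 2))).has_min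
    {m | m ≤ lo q ∧ a < withHorizons τ m} ⟨0, Fin.zero_le _, EReal.coe_lt_top a⟩
  obtain ⟨j, ⟨hj₁, hj₂⟩, hj₃⟩ := (wellFounded_lt (α := Fin (N + 2))).has_min
    {m | hi q ≤ m ∧ a < withHorizons τ m}
    ⟨Fin.last _, Fin.le_last _, by rw [withHorizons_last]; exact EReal.coe_lt_top a⟩
  refine ⟨indexPair i j, ⟨hi₁, hj₁⟩, (hi₁.trans_lt hq).trans_le hj₁, hi₂, hj₂, fun m h₁ h₂ => ?_⟩
  by_contra! hm
  rcases le_or_gt m (lo q) with h₃ | h₃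
  · exact hi₃ m ⟨h₃, hm⟩ h₁
  · rcases le_or_gt (hi q) m with h₄ | h₄
    · exact hj₃ m ⟨h₄, hm⟩ h₂
    · exact (h m h₃ h₄).not_gt hm

/-- Since `w` makes `p` and `q` overlap, if `q` stuck out of `p` then an end of `p` would lie inside
`q`; but the value there exceeds `a`. -/
theorem IsLevelPair.le_of_le {p q w : IndexPair N} {a : ℝ} (hp : IsLevelPair τ a p)
    (hq : ∀ m, lo q < m → m < hi q → withHorizons τ m ≤ a) (hw : lo w < hi w)
    (hwp : w ≤ p) (hwq : w ≤ q) : q ≤ p := by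
  rw [le_iff] at *
  constructor
  · by_contra! h
    exact (hq _ h (hwp.1.trans_lt (hw.trans_le hwq.2))).not_gt hp.left
  · by_contra! h
    exact (hq _ (hwq.1.trans_lt (hw.trans_le hwp.2)) h).not_gt hp.right

/-- Laminarity: overlapping visible pairs are nested, in the order of their levels. -/
theorem le_of_innerMax_le (hτ : ∀ i, 0 < τ i) {u v w : IndexPair N} (hu : u ∈ visiblePairs τ)
    (hw : lo w < hi w) (hwu : w ≤ u) (hwv : w ≤ v) (h : innerMax τ v ≤ innerMax τ u) : v ≤ u :=
  (isLevelPair_innerMax hτ hu).le_of_le ((innerMax_le_iff (innerMax_nonneg hτ u)).1 h) hw hwu hwv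

/-- The larger pair has an end of the smaller one in its interior, and by visibility that end beats
all inner values of the smaller pair. -/
theorem innerMax_strictMonoOn (hτ : ∀ i, 0 < τ i) :
    StrictMonoOn (innerMax τ) (visiblePairs τ) := by
  intro v hv u hu h
  have hl := isLevelPair_innerMax hτ hv
  rw [IndexPair.lt_iff, le_iff] at h
  rcases h with ⟨⟨h₁, h₂⟩, h | h⟩
  · exact EReal.coe_lt_coe_iff.1 (hl.left.trans_le (le_innerMax hτ h (hl.lt.trans_le h₂)))
  · exact EReal.coe_lt_coe_iff.1 (hl.right.trans_le (le_innerMax hτ (h₁.trans_lt hl.lt) h))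

theorem exists_parent (hτ : ∀ i, 0 < τ i) {w u : IndexPair N} (hw : w ∈ visiblePairs τ)
    (hu : u ∈ visiblePairs τ) (hwu : w < u) :
    ∃ v ∈ visiblePairs τ, w < v ∧ ∀ u ∈ visiblePairs τ, w < u → v ≤ u := by
  obtain ⟨v, hv⟩ := (Set.toFinite {v | v ∈ visiblePairs τ ∧ w < v}).exists_minimal ⟨u, hu, hwu⟩
  refine ⟨v, hv.1.1, hv.1.2, fun u hu hwu => ?_⟩
  rcases le_total (innerMax τ v) (innerMax τ u) with h | h
  · exact le_of_innerMax_le hτ hu hw.1 hwu.le hv.1.2.le h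
  · exact hv.2 ⟨hu, hwu⟩ (le_of_innerMax_le hτ hv.1.1 hw.1 hv.1.2.le hwu.le h)

theorem isLeaf_visiblePairs {p : IndexPair N} (h : IsLeaf (visiblePairs τ) p) :
    ((hi p : Fin _) : ℕ) = lo p + 1 := by
  have h₁ := h.1.1
  by_contra hne
  rw [Fin.lt_def] at h₁
  have := (hi p).2
  let j : Fin (N + 2) := ⟨lo p + 1, by omega⟩
  have hj : lo p < j := Fin.lt_def.2 (by simp [j])
  have hj' : j ≤ hi p := Fin.le_def.2 (by simp [j]; omega)
  have hmem : indexPair (lo p) j ∈ visiblePairs τ := mem_visiblePairs.2 ⟨hj, fun m h₂ h₃ => by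
    have h₂ : (lo p : ℕ) < m := Fin.lt_def.1 h₂
    have h₃ : (m : ℕ) < lo p + 1 := Fin.lt_def.1 h₃
    omega⟩
  have : ((hi p : Fin _) : ℕ) ≤ lo p + 1 := Fin.le_def.1 (h.2 hmem ⟨le_rfl, hj'⟩).2
  omega

theorem isLeaf_visiblePairs_iff {p : IndexPair N} (hp : p ∈ visiblePairs τ) :
    IsLeaf (visiblePairs τ) p ↔ ((hi p : Fin _) : ℕ) = lo p + 1 := by
  refine ⟨isLeaf_visiblePairs, fun h => ⟨hp, fun q hq hqp => ?_⟩⟩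
  have h₁ := Fin.lt_def.1 hq.1
  have h₂ := Fin.le_def.1 hqp.1
  have h₃ := Fin.le_def.1 hqp.2
  change (lo p : ℕ) ≤ lo q at h₂
  change ((hi q : Fin _) : ℕ) ≤ hi p at h₃
  exact ⟨Fin.le_def.2 (by change (lo q : ℕ) ≤ lo p; omega),
    Fin.le_def.2 (by change ((hi p : Fin _) : ℕ) ≤ hi q; omega)⟩

theorem mem_cutLeaves_visiblePairs {p : IndexPair N} : p ∈ cutLeaves (visiblePairs τ) ↔
    p ∈ visiblePairs τ ∧ ∃ l : Fin N, lo p < l.castSucc.succ ∧ l.castSucc.succ < hi p := by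
  refine and_congr_right fun hp => ?_
  rw [isLeaf_visiblePairs_iff hp]
  have h := Fin.lt_def.1 hp.1
  have := (hi p).2
  constructor
  · intro hne
    refine ⟨⟨lo p, by omega⟩, Fin.lt_def.2 ?_, Fin.lt_def.2 ?_⟩
    · simp
    · simp; omega
  · rintro ⟨l, h₁, h₂⟩ h₃
    rw [Fin.lt_def] at h₁ h₂
    omega

theorem innerMax_of_isLeaf (hτ : ∀ i, 0 < τ i) {p : IndexPair N}
    (h : IsLeaf (visiblePairs τ) p) : innerMax τ p = 0 := by
  refine le_antisymm ((innerMax_le_iff le_rfl).2 fun m h₁ h₂ => ?_) (innerMax_nonneg hτ p)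
  have := isLeaf_visiblePairs h
  rw [Fin.lt_def] at h₁ h₂
  omega

/-- The length of a descending path is the difference of the heights of its ends. -/
theorem sum_lengths_eq_sub {α : Type} [PartialOrder α] [Fintype α] {S : Set α} {h len : α → ℝ}
    (hS : ∀ w ∈ S, ∀ u ∈ S, w < u →
      ∃ v ∈ S, w < v ∧ (∀ u ∈ S, w < u → v ≤ u) ∧ len w = h v - h w)
    {l v : α} (hl : l ∈ S) (hv : v ∈ S) (hlv : l ≤ v) :
    ∑ w : α with w ∈ S ∧ l ≤ w ∧ w < v, len w = h v - h l := by
  -- The induction goes from the top down: the path from `l` is the edge above `l` followed by the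
  -- path from its parent.
  induction l using (wellFounded_gt (α := α)).induction with
  | _ l ih =>
    rcases hlv.eq_or_lt with rfl | hlt
    · rw [Finset.filter_false_of_mem, Finset.sum_empty, sub_self]
      exact fun w _ hw => (hw.2.1.trans_lt hw.2.2).false
    · obtain ⟨c, hc, hlc, hmin, hlen⟩ := hS l hl v hv hlt
      have : (Finset.univ.filter fun w : α => w ∈ S ∧ l ≤ w ∧ w < v) =
          insert l (Finset.univ.filter fun w : α => w ∈ S ∧ c ≤ w ∧ w < v) := by
        ext w
        simp only [Finset.mem_filter, Finset.mem_univ, true_and, Finset.mem_insert]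
        constructor
        · rintro ⟨h₁, h₂, h₃⟩
          rcases h₂.eq_or_lt with rfl | h₂
          · exact Or.inl rfl
          · exact Or.inr ⟨h₁, hmin w h₁ h₂, h₃⟩
        · rintro (rfl | ⟨h₁, h₂, h₃⟩)
          · exact ⟨hl, le_rfl, hlt⟩
          · exact ⟨h₁, hlc.le.trans h₂, h₃⟩
      rw [this, Finset.sum_insert (by simpa using fun _ h => absurd h hlc.not_ge),
        ih c hlc hc (hmin v hv hlt), hlen]
      ring

/-- All descending paths from `v` to a leaf have the same length, so the supremum is over a constant
family, nonempty by finiteness. -/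
theorem heightOfLengths_eq {α : Type} [PartialOrder α] [Fintype α] {S : Set α} {h len : α → ℝ}
    (hS : ∀ w ∈ S, ∀ u ∈ S, w < u →
      ∃ v ∈ S, w < v ∧ (∀ u ∈ S, w < u → v ≤ u) ∧ len w = h v - h w)
    (h0 : ∀ l, IsLeaf S l → h l = 0) {v : α} (hv : v ∈ S) : heightOfLengths S len v = h v := by
  have key : ∀ l : {l : α // IsLeaf S l ∧ l ≤ v},
      ∑ w : α with w ∈ S ∧ l.1 ≤ w ∧ w < v, len w = h v := by
    rintro ⟨l, hl, hlv⟩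
    rw [sum_lengths_eq_sub hS hl.1 hv hlv, h0 l hl, sub_zero]
  obtain ⟨l, hlv, hl⟩ := (Set.toFinite S).exists_le_minimal hv
  have : Nonempty {l : α // IsLeaf S l ∧ l ≤ v} := ⟨⟨l, hl, hlv⟩⟩
  simp_rw [heightOfLengths, key]
  exact ciSup_const

end VisiblePairs

/-! ### The merge tree of the weighted path -/

section MergeTree

open IndexPair

variable {N : ℕ} {τ : Fin N → ℝ}

/-- The leaves of the merge tree between the ends of a pair. -/
def segment (p : IndexPair N) : Set (Fin (N + 1)) :=
  {v | lo p ≤ v.castSucc ∧ v.succ ≤ hi p}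

theorem mem_segment {p : IndexPair N} {v : Fin (N + 1)} :
    v ∈ segment p ↔ (lo p : ℕ) ≤ v ∧ (v : ℕ) + 1 ≤ hi p := by
  rw [segment, Set.mem_ofPred, Fin.le_def, Fin.le_def]
  simp

/-- Compare the extreme leaves `lo p` and `hi p - 1`; they exist because `p` is nondegenerate. -/
theorem segment_subset_iff {p q : IndexPair N} (hp : lo p < hi p) :
    segment p ⊆ segment q ↔ p ≤ q := by
  have h := Fin.lt_def.1 hp
  have := (hi p).2
  rw [le_iff, Fin.le_def, Fin.le_def]
  constructor
  · intro hs
    have h₁ := mem_segment.1 (hs (mem_segment (v := ⟨lo p, by omega⟩).2 ⟨le_rfl, by simp; omega⟩))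
    have h₂ := mem_segment.1 (hs (mem_segment (v := ⟨hi p - 1, by omega⟩).2
      ⟨by simp only; omega, by simp only; omega⟩))
    simp only at h₁ h₂
    omega
  · intro hpq v hv
    rw [mem_segment] at *
    omega

theorem segment_inj {p q : IndexPair N} (hp : lo p < hi p) (hq : lo q < hi q)
    (h : segment p = segment q) : p = q :=
  le_antisymm ((segment_subset_iff hp).1 h.subset) ((segment_subset_iff hq).1 h.superset)

/-- The regions just after the leaves of the segment fill `(lo p, hi p]` and those just before them
fill `[lo p, hi p)`; the symmetric difference consists of the two ends. -/
theorem onBoundary_segment {p : IndexPair N} (hp : lo p < hi p) (g : Fin (N + 2)) :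
    OnBoundary (segment p) g ↔ g = lo p ∨ g = hi p := by
  have h := Fin.lt_def.1 hp
  have := (hi p).2
  have hg := g.2
  have h₁ : (∃ v ∈ segment p, v.succ = g) ↔ (lo p : ℕ) < g ∧ (g : ℕ) ≤ hi p := by
    constructor
    · rintro ⟨v, hv, rfl⟩
      rw [mem_segment] at hv
      simp only [Fin.val_succ]
      omega
    · intro hg
      refine ⟨⟨g - 1, by omega⟩, mem_segment.2 ⟨by simp only; omega, by simp only; omega⟩,
        Fin.ext (by simp; omega)⟩
  have h₂ : (∃ v ∈ segment p, v.castSucc = g) ↔ (lo p : ℕ) ≤ g ∧ (g : ℕ) < hi p := by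
    constructor
    · rintro ⟨v, hv, rfl⟩
      rw [mem_segment] at hv
      simp only [Fin.val_castSucc]
      omega
    · intro hg
      exact ⟨⟨g, by omega⟩, mem_segment.2 ⟨by simp only; omega, by simp only; omega⟩, rfl⟩
  rw [OnBoundary, h₁, h₂, Fin.ext_iff, Fin.ext_iff, xor_def]
  omega

theorem weightedPath_weight (i : Fin N) :
    (weightedPath τ).weight s(i.castSucc, i.succ) = τ i := by
  change ∑ j : Fin N, (if s(i.castSucc, i.succ) = s(j.castSucc, j.succ) then τ j else 0) = _
  rw [Finset.sum_eq_single i, if_pos rfl]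
  · intro j _ hj
    rw [if_neg]
    rw [Sym2.eq_iff]
    simp only [Fin.ext_iff, Fin.val_castSucc, Fin.val_succ] at *
    omega
  · simp

theorem sublevel_adj_iff {a : ℝ} {v w : Fin (N + 1)} (h : (w : ℕ) = v + 1) :
    ((weightedPath τ).sublevel a).Adj v w ↔ withHorizons τ v.succ ≤ a := by
  have hw := w.2
  obtain ⟨i, rfl, rfl⟩ : ∃ i : Fin N, v = i.castSucc ∧ w = i.succ :=
    ⟨⟨v, by omega⟩, rfl, Fin.ext h⟩
  rw [withHorizons_castSucc_succ, EReal.coe_le_coe_iff, ← weightedPath_weight (τ := τ) i]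
  refine and_iff_right ?_
  rw [weightedPath, SimpleGraph.pathGraph_adj]
  exact Or.inl h.symm

/-- The values met on the way from `v` to `w` are at most `a`. -/
def BoundedBetween (τ : Fin N → ℝ) (a : ℝ) (v w : Fin (N + 1)) : Prop :=
  ∀ m : Fin (N + 2), (v : ℕ) < m → (m : ℕ) ≤ w → withHorizons τ m ≤ a

/-- Whichever of `v` and `w` is smaller, one of the two conditions is vacuous, so the conjunction
avoids a case distinction on the direction. -/
theorem reachable_sublevel_iff {a : ℝ} {v w : Fin (N + 1)} :
    ((weightedPath τ).sublevel a).Reachable v w ↔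
      BoundedBetween τ a v w ∧ BoundedBetween τ a w v := by
  constructor
  · rintro ⟨p⟩
    induction p with
    | nil => exact ⟨fun m _ _ => by omega, fun m _ _ => by omega⟩
    | @cons u v w h p ih =>
      have huv : BoundedBetween τ a u v ∧ BoundedBetween τ a v u := by
        have hadj := h.1
        rw [weightedPath, SimpleGraph.pathGraph_adj] at hadj
        rcases hadj with h' | h'
        · have := (sublevel_adj_iff h'.symm).1 h
          refine ⟨fun m h₁ h₂ => ?_, fun m h₁ h₂ => by omega⟩
          rwa [show m = u.succ from Fin.ext (by simp; omega)]
        · have := (sublevel_adj_iff h'.symm).1 h.symm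
          refine ⟨fun m h₁ h₂ => by omega, fun m h₁ h₂ => ?_⟩
          rwa [show m = v.succ from Fin.ext (by simp; omega)]
      constructor
      · intro m h₁ h₂
        rcases le_or_gt (m : ℕ) v with h₃ | h₃
        · exact huv.1 m h₁ h₃
        · exact ih.1 m h₃ h₂
      · intro m h₁ h₂
        rcases le_or_gt (m : ℕ) v with h₃ | h₃
        · exact ih.2 m h₁ h₃
        · exact huv.2 m h₃ h₂
  · have key : ∀ (n : ℕ) (v w : Fin (N + 1)), (w : ℕ) = v + n → BoundedBetween τ a v w →
        ((weightedPath τ).sublevel a).Reachable v w := by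
      intro n
      induction n with
      | zero =>
        intro v w h _
        rw [show w = v from Fin.ext h]
      | succ n ih =>
        intro v w h hb
        have hw := w.2
        let u : Fin (N + 1) := ⟨v + n, by omega⟩
        have huw : (w : ℕ) = u + 1 := h
        refine (ih v u rfl fun m h₁ h₂ => hb m h₁ (by omega)).trans
          (SimpleGraph.Adj.reachable ((sublevel_adj_iff huw).2 (hb _ ?_ ?_)))
        · simp [u]
        · simp [u]; omega
    rintro ⟨h₁, h₂⟩
    rcases le_total (v : ℕ) w with h | h
    · exact key (w - v) v w (by omega) h₁
    · exact (key (v - w) w v (by omega) h₂).symm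

theorem IsLevelPair.supp_eq_segment {a : ℝ} {p : IndexPair N} (hp : IsLevelPair τ a p)
    {v : Fin (N + 1)} (hv : v ∈ segment p) :
    (((weightedPath τ).sublevel a).connectedComponentMk v).supp = segment p := by
  ext w
  rw [SimpleGraph.ConnectedComponent.mem_supp_iff, SimpleGraph.ConnectedComponent.eq,
    reachable_sublevel_iff]
  rw [mem_segment] at *
  constructor
  · intro h
    by_contra! hw
    rcases lt_or_ge (w : ℕ) (lo p) with h' | h'
    · exact (h.1 (lo p) h' hv.1).not_gt hp.left
    · exact (h.2 (hi p) (by omega) (by have := hw h'; omega)).not_gt hp.right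
  · intro hw
    exact ⟨fun m h₁ h₂ => hp.inner m (Fin.lt_def.2 (by omega)) (Fin.lt_def.2 (by omega)),
      fun m h₁ h₂ => hp.inner m (Fin.lt_def.2 (by omega)) (Fin.lt_def.2 (by omega))⟩

theorem isComponent_iff {a : ℝ} {C : Set (Fin (N + 1))} :
    (weightedPath τ).IsComponent a C ↔ ∃ p, IsLevelPair τ a p ∧ C = segment p := by
  constructor
  · rintro ⟨c, rfl⟩
    induction c using SimpleGraph.ConnectedComponent.ind with
    | _ v =>
      obtain ⟨p, hle, hp⟩ := exists_isLevelPair (τ := τ) (q := indexPair v.castSucc v.succ) (a := a)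
        (Fin.castSucc_lt_succ) fun m h₁ h₂ => by
          have h₁ : (v : ℕ) < m := Fin.lt_def.1 h₁
          have h₂ : (m : ℕ) < v + 1 := Fin.lt_def.1 h₂
          omega
      exact ⟨p, hp, hp.supp_eq_segment hle⟩
  · rintro ⟨p, hp, rfl⟩
    have h := Fin.lt_def.1 hp.lt
    have := (hi p).2
    exact ⟨_, hp.supp_eq_segment (mem_segment (v := ⟨lo p, by omega⟩).2
      ⟨le_rfl, by simp only; omega⟩)⟩

theorem mem_mergeTree_nodes (hτ : ∀ i, 0 < τ i) {C : Set (Fin (N + 1))} :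
    C ∈ (weightedPath τ).mergeTree.nodes ↔ ∃ p ∈ visiblePairs τ, C = segment p := by
  constructor
  · rintro ⟨a, -, hC⟩
    obtain ⟨p, hp, rfl⟩ := isComponent_iff.1 hC
    exact ⟨p, hp.mem_visiblePairs, rfl⟩
  · rintro ⟨p, hp, rfl⟩
    exact ⟨_, innerMax_nonneg hτ p, isComponent_iff.2 ⟨p, isLevelPair_innerMax hτ hp, rfl⟩⟩

theorem mergeTree_height_segment (hτ : ∀ i, 0 < τ i) {p : IndexPair N} (hp : p ∈ visiblePairs τ) :
    (weightedPath τ).mergeTree.height (segment p) = innerMax τ p := by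
  refine IsLeast.csInf_eq ⟨⟨innerMax_nonneg hτ p,
    isComponent_iff.2 ⟨p, isLevelPair_innerMax hτ hp, rfl⟩⟩, ?_⟩
  rintro a ⟨ha, hC⟩
  obtain ⟨q, hq, h⟩ := isComponent_iff.1 hC
  rw [segment_inj hp.1 hq.lt h]
  exact hq.innerMax_le ha

theorem segment_lt_iff {p q : IndexPair N} (hp : lo p < hi p) (hq : lo q < hi q) :
    segment p < segment q ↔ p < q := by
  rw [lt_iff_le_not_ge, lt_iff_le_not_ge]
  exact and_congr (segment_subset_iff hp) (not_congr (segment_subset_iff hq))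

theorem edgeLength_segment (hτ : ∀ i, 0 < τ i) (r : ℝ) {w v : IndexPair N}
    (hw : w ∈ visiblePairs τ) (hv : v ∈ visiblePairs τ) (hwv : w < v)
    (hmin : ∀ u ∈ visiblePairs τ, w < u → v ≤ u) :
    (weightedPath τ).mergeTree.edgeLength r (segment w) = innerMax τ v - innerMax τ w := by
  have hlt := (segment_lt_iff hw.1 hv.1).2 hwv
  have hmem := (mem_mergeTree_nodes hτ).2 ⟨v, hv, rfl⟩
  rw [HeightTree.edgeLength, if_pos ⟨_, hmem, hlt⟩, mergeTree_height_segment hτ hw]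
  congr 1
  refine IsLeast.csInf_eq ⟨⟨_, ⟨hmem, hlt⟩, mergeTree_height_segment hτ hv⟩, ?_⟩
  rintro _ ⟨C, ⟨hC, hlt'⟩, rfl⟩
  obtain ⟨u, hu, rfl⟩ := (mem_mergeTree_nodes hτ).1 hC
  rw [mergeTree_height_segment hτ hu]
  exact (innerMax_strictMonoOn hτ).monotoneOn hv hu
    (hmin u hu ((segment_lt_iff hw.1 hu.1).1 hlt'))

theorem persistenceWeightedHVG_weight (hτ : ∀ i, 0 < τ i) (r : ℝ) {p : IndexPair N}
    (hp : p ∈ visiblePairs τ) : (persistenceWeightedHVG τ r).weight s(lo p, hi p) =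
      (weightedPath τ).mergeTree.edgeLength r (segment p) := by
  change ∑ C : Set (Fin (N + 1)) with C ∈ (weightedPath τ).mergeTree.nodes ∧
    ∀ g ∈ s(lo p, hi p), OnBoundary C g, (weightedPath τ).mergeTree.edgeLength r C = _
  have : (Finset.univ.filter fun C : Set (Fin (N + 1)) => C ∈ (weightedPath τ).mergeTree.nodes ∧
      ∀ g ∈ s(lo p, hi p), OnBoundary C g) = {segment p} := by
    ext C
    simp only [Finset.mem_filter, Finset.mem_univ, true_and, Finset.mem_singleton, Sym2.mem_iff,
      forall_eq_or_imp, forall_eq, mem_mergeTree_nodes hτ]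
    constructor
    · rintro ⟨⟨q, hq, rfl⟩, h₁, h₂⟩
      rw [onBoundary_segment hq.1] at h₁ h₂
      have hp' := hp.1
      have hq' := hq.1
      congr 1
      refine Prod.ext (congrArg OrderDual.toDual (?_ : lo q = lo p)) (?_ : hi q = hi p)
      · omega
      · omega
    · rintro rfl
      exact ⟨⟨p, hp, rfl⟩, (onBoundary_segment hp.1 _).2 (Or.inl rfl),
        (onBoundary_segment hp.1 _).2 (Or.inr rfl)⟩
  rw [this, Finset.sum_singleton]

/-- The edge lengths are differences of `innerMax`, which is zero at the leaves, so path sums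
telescope. Only edges strictly below `p` are summed, hence `r` drops out. -/
theorem dualTree_height (hτ : ∀ i, 0 < τ i) (r : ℝ) {p : IndexPair N} (hp : p ∈ visiblePairs τ) :
    (dualTree (persistenceWeightedHVG τ r)).height p = innerMax τ p := by
  refine heightOfLengths_eq (fun w hw u hu hwu => ?_) (fun l => innerMax_of_isLeaf hτ) hp
  obtain ⟨v, hv, hwv, hmin⟩ := exists_parent hτ hw hu hwu
  exact ⟨v, hv, hwv, hmin, (persistenceWeightedHVG_weight hτ r hw).trans
    (edgeLength_segment hτ r hw hv hwv hmin)⟩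

end MergeTree

/-! ### Leaves and deaths of a pruned tree -/

section Pruning

variable {α : Type} [PartialOrder α] [Finite α] {S : Set α}

theorem exists_isLeaf_le {v : α} (hv : v ∈ S) : ∃ l, IsLeaf S l ∧ l ≤ v := by
  obtain ⟨l, hl, h⟩ := (Set.toFinite S).exists_le_minimal hv
  exact ⟨l, h, hl⟩

theorem exists_isChild_ge {l v : α} (hl : l ∈ S) (hv : v ∈ S) (h : l < v) :
    ∃ c, IsChild S c v ∧ l ≤ c := by
  obtain ⟨c, hlc, hc⟩ := (Set.toFinite {c | c ∈ S ∧ c < v}).exists_le_maximal ⟨hl, h⟩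
  exact ⟨c, ⟨hc.1.1, hv, hc.1.2, fun d hd hcd hdv => hcd.not_ge (hc.2 ⟨hd, hdv⟩ hcd.le)⟩, hlc⟩

/-- A leaf has no child, so it is never suppressed, and every node has a leaf below it. -/
theorem isLeaf_suppressDegreeTwo_iff {l : α} : IsLeaf (suppressDegreeTwo S) l ↔ IsLeaf S l := by
  have key : ∀ l, IsLeaf S l → l ∈ suppressDegreeTwo S := fun l hl =>
    ⟨hl.1, fun ⟨_, hc, _⟩ => hc.2.2.1.not_ge (hl.2 hc.1 hc.2.2.1.le)⟩
  constructor
  · intro h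
    obtain ⟨l', hl', hle⟩ := exists_isLeaf_le h.1.1
    rwa [← (h.eq_of_le (key l' hl') hle)]
  · exact fun h => ⟨key l h, fun v hv hvl => h.2 hv.1 hvl⟩

/-- A lowest common ancestor of two leaves survives the suppression of vertices of degree two. -/
theorem exists_common_ancestor_suppressDegreeTwo {l l' v : α} (hl : IsLeaf S l) (hl' : IsLeaf S l')
    (hne : l ≠ l') (hv : v ∈ S) (hlv : l ≤ v) (hlv' : l' ≤ v) :
    ∃ u ∈ suppressDegreeTwo S, l ≤ u ∧ l' ≤ u ∧ u ≤ v := by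
  obtain ⟨u, huv, hu⟩ := (Set.toFinite {u | u ∈ S ∧ l ≤ u ∧ l' ≤ u}).exists_le_minimal
    ⟨hv, hlv, hlv'⟩
  obtain ⟨⟨huS, hlu, hlu'⟩, hmin⟩ := hu
  refine ⟨u, ⟨huS, ?_⟩, hlu, hlu', huv⟩
  -- If the minimal common ancestor `u` had only one child, both leaves would lie below that child,
  -- against minimality.
  rintro ⟨c, -, huniq⟩
  have hlt : l < u := hlu.lt_of_ne fun h => hne (hl.eq_of_le hl'.1 (h ▸ hlu')).symm
  have hlt' : l' < u := hlu'.lt_of_ne fun h => hne (hl'.eq_of_le hl.1 (h ▸ hlu))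
  obtain ⟨d, hd, hld⟩ := exists_isChild_ge hl.1 huS hlt
  obtain ⟨d', hd', hld'⟩ := exists_isChild_ge hl'.1 huS hlt'
  obtain rfl : d = d' := (huniq d hd).trans (huniq d' hd').symm
  exact hd.2.2.1.not_ge (hmin ⟨hd.1, hld, hld'⟩ hd.2.2.1.le)

end Pruning

/-! ### The elder rule -/

section ElderRule

theorem HeightTree.older_isStrictTotalOrder {α : Type} (T : HeightTree α) (tie : α → α → Prop)
    [IsStrictTotalOrder α tie] : IsStrictTotalOrder α (T.Older tie) where
  irrefl := by
    rintro l (h | h)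
    · exact h.false
    · exact irrefl_of tie l h.2
  trans := by
    rintro l₁ l₂ l₃ (h | ⟨h, ht⟩) (h' | ⟨h', ht'⟩)
    · exact Or.inl (h.trans h')
    · exact Or.inl (h.trans_eq h')
    · exact Or.inl (h.trans_lt h')
    · exact Or.inr ⟨h.trans h', _root_.trans ht ht'⟩
  trichotomous := by
    intro l₁ l₂ h₁ h₂
    simp only [HeightTree.Older, not_or, not_and, not_lt] at h₁ h₂
    have h := le_antisymm h₂.1 h₁.1
    rcases trichotomous_of tie l₁ l₂ with ht | ht | ht
    · exact absurd ht (h₁.2 h)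
    · exact ht
    · exact absurd ht (h₂.2 h.symm)

theorem HeightTree.elderRule_eq_map_leaves {α : Type} [PartialOrder α] [Fintype α]
    (T : HeightTree α) (tie : α → α → Prop) : T.elderRule tie =
      (Finset.univ : Finset {l : α // IsLeaf T.nodes l}).val.map
        fun l => (T.height l.1, T.death tie l.1) := by
  rw [HeightTree.elderRule, ← Finset.univ_val_map_subtype_val, Multiset.map_map]
  rfl

/-- A finite death height is the height of an ancestor shared with an older leaf. -/
theorem HeightTree.exists_death_eq {α : Type} [PartialOrder α] [Finite α] {T : HeightTree α}
    {tie : α → α → Prop} {l : α} (h : T.death tie l ≠ ⊤) :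
    ∃ v ∈ T.nodes, l ≤ v ∧ (∃ l', IsLeaf T.nodes l' ∧ l' ≤ v ∧ T.Older tie l' l) ∧
      T.death tie l = (T.height v : EReal) := by
  refine Set.Nonempty.csInf_mem (s := {d : EReal | ∃ v ∈ T.nodes, l ≤ v ∧
    (∃ l', IsLeaf T.nodes l' ∧ l' ≤ v ∧ T.Older tie l' l) ∧ d = (T.height v : EReal)}) ?_ ?_
  · rw [Set.nonempty_iff_ne_empty]
    intro he
    refine h ?_
    rw [HeightTree.death, he, sInf_empty]
  · refine (Set.finite_range fun v => (T.height v : EReal)).subset ?_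
    rintro _ ⟨v, -, -, -, rfl⟩
    exact ⟨v, rfl⟩

open IndexPair

variable {N : ℕ} {τ : Fin N → ℝ}

/-- The index `l` lies strictly between the ends of the pair. -/
def IsInner (p : IndexPair N) (l : Fin N) : Prop :=
  lo p < l.castSucc.succ ∧ l.castSucc.succ < hi p

theorem IsInner.mono {p q : IndexPair N} {l : Fin N} (h : IsInner p l) (hpq : p ≤ q) :
    IsInner q l :=
  ⟨lt_of_le_of_lt hpq.1 h.1, lt_of_lt_of_le h.2 hpq.2⟩

/-- The value `τ l` sits at vertex `l + 1`, whose neighbours are `l` and `l + 2`. This form supplies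
the overlap `w` that `le_of_innerMax_le` and `IsLevelPair.le_of_le` need. -/
theorem isInner_iff_le {p : IndexPair N} {l : Fin N} :
    IsInner p l ↔ indexPair l.castSucc.castSucc l.succ.succ ≤ p := by
  change _ ↔ lo p ≤ l.castSucc.castSucc ∧ l.succ.succ ≤ hi p
  rw [IsInner]
  simp only [Fin.lt_def, Fin.le_def, Fin.val_succ, Fin.val_castSucc]
  omega

theorem IsInner.le_innerMax (hτ : ∀ i, 0 < τ i) {p : IndexPair N} {l : Fin N} (h : IsInner p l) :
    τ l ≤ innerMax τ p := by
  have := HorizonTree.le_innerMax hτ h.1 h.2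
  rwa [withHorizons_castSucc_succ, EReal.coe_le_coe_iff] at this

theorem sameComponent_of_isInner (hτ : ∀ i, 0 < τ i) {p : IndexPair N} {l m : Fin N} {a : ℝ}
    (hl : IsInner p l) (hm : IsInner p m) (ha : innerMax τ p ≤ a) :
    SameComponent (piecewiseLinear τ) (sampleTime l) (sampleTime m) a := by
  wlog hlm : l ≤ m generalizing l m
  · exact (this hm hl (le_of_not_ge hlm)).symm
  refine (sameComponent_sampleTime_iff hlm).2 fun j h₁ h₂ => ?_
  refine le_trans (IsInner.le_innerMax hτ ⟨hl.1.trans_le ?_, lt_of_le_of_lt ?_ hm.2⟩) ha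
  · simpa using h₁
  · simpa using h₂

theorem lo_lt_hi_of_le {l m : Fin N} (h : l ≤ m) :
    lo (indexPair l.castSucc.castSucc m.succ.succ) <
      hi (indexPair l.castSucc.castSucc m.succ.succ) := by
  rw [lo_indexPair, hi_indexPair]
  simp only [Fin.lt_def, Fin.le_def, Fin.val_succ, Fin.val_castSucc] at *
  omega

theorem exists_isLevelPair_of_forall_le {l m : Fin N} {a : ℝ} (hlm : l ≤ m)
    (h : ∀ j, l ≤ j → j ≤ m → τ j ≤ a) : ∃ p, IsInner p l ∧ IsInner p m ∧ IsLevelPair τ a p := by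
  have hlm' : (l : ℕ) ≤ m := hlm
  obtain ⟨p, hp, hl⟩ := exists_isLevelPair (τ := τ)
    (q := indexPair l.castSucc.castSucc m.succ.succ) (a := a)
    (lo_lt_hi_of_le hlm) fun j h₁ h₂ => by
      obtain ⟨i, rfl⟩ := exists_eq_castSucc_succ h₁ h₂
      rw [withHorizons_castSucc_succ, EReal.coe_le_coe_iff]
      rw [lo_indexPair] at h₁
      rw [hi_indexPair] at h₂
      simp only [Fin.lt_def, Fin.val_succ, Fin.val_castSucc] at h₁ h₂
      exact h i (Fin.le_def.2 (by omega)) (Fin.le_def.2 (by omega))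
  refine ⟨p, IsInner.mono ⟨?_, ?_⟩ hp, IsInner.mono ⟨?_, ?_⟩ hp, hl⟩
  all_goals
    rw [Fin.lt_def]
    first | rw [lo_indexPair] | rw [hi_indexPair]
    simp only [Fin.val_succ, Fin.val_castSucc]
    omega

theorem isInner_mem_cutLeaves {p : IndexPair N} {l : Fin N} (hp : p ∈ visiblePairs τ)
    (h : IsInner p l) : p ∈ cutLeaves (visiblePairs τ) :=
  mem_cutLeaves_visiblePairs.2 ⟨hp, l, h⟩

/-- A leaf of the tree with its leaves cut off spans a plateau. -/
theorem eq_innerMax_of_isLeaf (hτ : ∀ i, 0 < τ i) {p : IndexPair N} {l : Fin N}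
    (hp : IsLeaf (cutLeaves (visiblePairs τ)) p) (hl : IsInner p l) : τ l = innerMax τ p := by
  have hle := hl.le_innerMax hτ
  -- The maximal run around `l` at level `τ l` is a descendant of `p` that survives the cut, so it
  -- is `p` itself.
  obtain ⟨q, hq, -, hlev⟩ := exists_isLevelPair_of_forall_le (τ := τ) (a := τ l) (le_refl l)
    fun j h₁ h₂ => by rw [le_antisymm h₂ h₁]
  have hqm := hlev.innerMax_le (hτ l).le
  have hqp := le_of_innerMax_le hτ hp.1.1 (lo_lt_hi_of_le (le_refl l)) (isInner_iff_le.1 hl) (isInner_iff_le.1 hq)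
    (hqm.trans hle)
  rw [← hp.eq_of_le (isInner_mem_cutLeaves hlev.mem_visiblePairs hq) hqp] at hle ⊢
  exact le_antisymm hle hqm

/-- The ancestor is the maximal run at level `a` around both samples. It contains the whole of `p`
and `q`, since their plateaus have values at most `a` and meet it. -/
theorem exists_common_ancestor_of_sameComponent (hτ : ∀ i, 0 < τ i) {p q : IndexPair N}
    {l m : Fin N} {a : ℝ} (hp : IsLeaf (cutLeaves (visiblePairs τ)) p)
    (hq : IsLeaf (cutLeaves (visiblePairs τ)) q) (hl : IsInner p l) (hm : IsInner q m)
    (h : SameComponent (piecewiseLinear τ) (sampleTime l) (sampleTime m) a) :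
    ∃ v ∈ cutLeaves (visiblePairs τ), p ≤ v ∧ q ≤ v ∧ innerMax τ v ≤ a := by
  wlog hlm : l ≤ m generalizing l m p q
  · obtain ⟨v, hv, h₁, h₂, h₃⟩ := this hq hp hm hl h.symm (le_of_not_ge hlm)
    exact ⟨v, hv, h₂, h₁, h₃⟩
  have hle := (sameComponent_sampleTime_iff hlm).1 h
  obtain ⟨v, hvl, hvm, hv⟩ := exists_isLevelPair_of_forall_le hlm hle
  have ha : 0 ≤ a := (hτ l).le.trans (hle l le_rfl hlm)
  have key : ∀ {p : IndexPair N} {l : Fin N}, IsLeaf (cutLeaves (visiblePairs τ)) p →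
      IsInner p l → IsInner v l → τ l ≤ a → p ≤ v := fun {p l} hp hl hvl hla =>
    hv.le_of_le ((innerMax_le_iff ha).1 ((eq_innerMax_of_isLeaf hτ hp hl).symm.trans_le hla))
      (lo_lt_hi_of_le (le_refl l))
      (isInner_iff_le.1 hvl) (isInner_iff_le.1 hl)
  exact ⟨v, isInner_mem_cutLeaves hv.mem_visiblePairs hvl, key hp hl hvl (hle l le_rfl hlm),
    key hq hm hvm (hle m hlm le_rfl), hv.innerMax_le ha⟩

/-- The first Horton pruning of the dual tree. -/
abbrev prunedTree (τ : Fin N → ℝ) (r : ℝ) : HeightTree (IndexPair N) :=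
  (dualTree (persistenceWeightedHVG τ r)).hortonPruning

theorem isLeaf_prunedTree_iff {r : ℝ} {p : IndexPair N} :
    IsLeaf (prunedTree τ r).nodes p ↔ IsLeaf (cutLeaves (visiblePairs τ)) p :=
  isLeaf_suppressDegreeTwo_iff

theorem prunedTree_height (hτ : ∀ i, 0 < τ i) (r : ℝ) {p : IndexPair N}
    (hp : p ∈ visiblePairs τ) : (prunedTree τ r).height p = innerMax τ p :=
  dualTree_height hτ r hp

theorem mem_visiblePairs_of_mem_prunedTree {r : ℝ} {p : IndexPair N}
    (hp : p ∈ (prunedTree τ r).nodes) : p ∈ visiblePairs τ :=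
  hp.1.1

theorem exists_isInner {r : ℝ} (p : {p // IsLeaf (prunedTree τ r).nodes p}) :
    ∃ l, IsInner p.1 l :=
  (mem_cutLeaves_visiblePairs.1 (isLeaf_prunedTree_iff.1 p.2).1).2

/-- A sample time in the plateau of a leaf. -/
def leafTime (τ : Fin N → ℝ) (r : ℝ) (p : {p // IsLeaf (prunedTree τ r).nodes p}) :
    Set.Icc (1 : ℝ) N :=
  sampleTime (exists_isInner p).choose

theorem piecewiseLinear_leafTime (hτ : ∀ i, 0 < τ i) {r : ℝ}
    (p : {p // IsLeaf (prunedTree τ r).nodes p}) :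
    piecewiseLinear τ (leafTime τ r p) = (prunedTree τ r).height p := by
  have hp := isLeaf_prunedTree_iff.1 p.2
  rw [leafTime, piecewiseLinear_sampleTime,
    eq_innerMax_of_isLeaf hτ hp (exists_isInner p).choose_spec, prunedTree_height hτ r hp.1.1]

theorem sameComponent_leafTime_iff (hτ : ∀ i, 0 < τ i) {r : ℝ}
    {p q : {p // IsLeaf (prunedTree τ r).nodes p}} {a : ℝ} :
    SameComponent (piecewiseLinear τ) (leafTime τ r p) (leafTime τ r q) a ↔
      ∃ v ∈ cutLeaves (visiblePairs τ), p.1 ≤ v ∧ q.1 ≤ v ∧ innerMax τ v ≤ a := by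
  have hp := (exists_isInner p).choose_spec
  have hq := (exists_isInner q).choose_spec
  constructor
  · exact exists_common_ancestor_of_sameComponent hτ (isLeaf_prunedTree_iff.1 p.2)
      (isLeaf_prunedTree_iff.1 q.2) hp hq
  · rintro ⟨v, -, hpv, hqv, hva⟩
    exact sameComponent_of_isInner hτ (hp.mono hpv) (hq.mono hqv) hva

theorem elderData_prunedTree (hτ : ∀ i, 0 < τ i) (r : ℝ)
    (tie : IndexPair N → IndexPair N → Prop) [IsStrictTotalOrder (IndexPair N) tie] :
    ElderData (piecewiseLinear τ)
      (Order.Preimage Subtype.val ((prunedTree τ r).Older tie)) (leafTime τ r)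
      fun p => ((prunedTree τ r).height p, (prunedTree τ r).death tie p) := by
  have hord := (prunedTree τ r).older_isStrictTotalOrder tie
  have hheight : ∀ {p}, p ∈ (prunedTree τ r).nodes → (prunedTree τ r).height p = innerMax τ p :=
    fun hp => prunedTree_height hτ r (mem_visiblePairs_of_mem_prunedTree hp)
  refine ⟨fun p => (piecewiseLinear_leafTime hτ p).symm, fun p q h => ?_, fun a x hx => ?_,
    fun p q a h ha hpq => ?_, fun p h => ?_, fun p => ?_⟩
  · rw [piecewiseLinear_leafTime hτ, piecewiseLinear_leafTime hτ]
    rcases h with h | h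
    · exact h.le
    · exact h.1.le
  · obtain ⟨l, hl⟩ := exists_sameComponent_sampleTime hx
    have hla := hl.2.choose
    rw [piecewiseLinear_sampleTime] at hla
    obtain ⟨v, hvl, -, hv⟩ := exists_isLevelPair_of_forall_le (τ := τ) (a := a) (le_refl l)
      fun j h₁ h₂ => by rwa [le_antisymm h₂ h₁]
    obtain ⟨p, hp, hpv⟩ := exists_isLeaf_le (isInner_mem_cutLeaves hv.mem_visiblePairs hvl)
    let p' : {p // IsLeaf (prunedTree τ r).nodes p} := ⟨p, isLeaf_prunedTree_iff.2 hp⟩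
    exact ⟨p', hl.trans (sameComponent_of_isInner hτ hvl
      ((exists_isInner p').choose_spec.mono hpv) (hv.innerMax_le ((hτ l).le.trans hla)))⟩
  · obtain ⟨v, hv, hpv, hqv, hva⟩ := (sameComponent_leafTime_iff hτ).1 hpq
    have hne : p.1 ≠ q.1 := fun e => irrefl_of ((prunedTree τ r).Older tie) p.1 (by
      have h : (prunedTree τ r).Older tie q.1 p.1 := h
      rwa [← e] at h)
    -- The death is an infimum over nodes of the pruned tree, where `v` may be suppressed; a lower
    -- common ancestor `u` survives and bounds the death by its height.
    obtain ⟨u, hu, hpu, hqu, huv⟩ := exists_common_ancestor_suppressDegreeTwo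
      (isLeaf_prunedTree_iff.1 p.2) (isLeaf_prunedTree_iff.1 q.2) hne hv hpv hqv
    have hd : (prunedTree τ r).death tie p ≤ ((prunedTree τ r).height u : EReal) :=
      sInf_le ⟨u, hu, hpu, ⟨q, q.2, hqu, h⟩, rfl⟩
    rw [hheight hu] at hd
    refine (ha.trans_le hd).not_ge (EReal.coe_le_coe_iff.2 (le_trans ?_ hva))
    exact (innerMax_strictMonoOn hτ).monotoneOn hu.1.1 hv.1 huv
  · obtain ⟨v, hv, hpv, ⟨q, hq, hqv, hqp⟩, hd⟩ := HeightTree.exists_death_eq h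
    refine ⟨⟨q, hq⟩, hqp, fun a ha => (sameComponent_leafTime_iff hτ).2 ⟨v, hv.1, hpv, hqv, ?_⟩⟩
    simp only [hd, hheight hv, EReal.coe_le_coe_iff] at ha
    exact ha
  · by_cases h : (prunedTree τ r).death tie p = ⊤
    · simp only [h]
      exact EReal.coe_lt_top _
    · obtain ⟨v, hv, hpv, ⟨q, hq, hqv, hqp⟩, hd⟩ := HeightTree.exists_death_eq h
      simp only [hd, hheight hv, hheight p.2.1, EReal.coe_lt_coe_iff]
      -- The bar is nonempty because the merging node lies strictly above `p`: otherwise the older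
      -- leaf `q` would lie below the leaf `p`, hence equal it and be older than itself.
      refine innerMax_strictMonoOn hτ p.2.1.1.1 hv.1.1 (hpv.lt_of_ne ?_)
      intro e
      rw [← e] at hqv
      rw [p.2.eq_of_le hq.1 hqv] at hqp
      exact irrefl_of ((prunedTree τ r).Older tie) _ hqp

theorem isBarcode_elderRule (hτ : ∀ i, 0 < τ i) (r : ℝ)
    (tie : IndexPair N → IndexPair N → Prop) [IsStrictTotalOrder (IndexPair N) tie]
    (k : Type*) [Field k] :
    IsBarcode (sublevelH0 k (piecewiseLinear τ)) ((prunedTree τ r).elderRule tie) := by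
  have hord := (prunedTree τ r).older_isStrictTotalOrder tie
  have : IsStrictTotalOrder _ (Order.Preimage Subtype.val ((prunedTree τ r).Older tie)) :=
    (RelEmbedding.preimage (Function.Embedding.subtype
    (IsLeaf (prunedTree τ r).nodes)) ((prunedTree τ r).Older tie)).isStrictTotalOrder
  rw [HeightTree.elderRule_eq_map_leaves]
  exact (elderData_prunedTree hτ r tie).isBarcode (k := k)

end ElderRule

end HorizonTree

end

theorem mainTheorem6 {N : ℕ} (hN : 1 ≤ N) (τ : Fin N → ℝ) (hτ : ∀ i, 0 < τ i)
    (r : ℝ) (hr : 0 < r)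
    (tie : (Fin (N + 2))ᵒᵈ × Fin (N + 2) → (Fin (N + 2))ᵒᵈ × Fin (N + 2) → Prop)
    (htie : IsStrictTotalOrder ((Fin (N + 2))ᵒᵈ × Fin (N + 2)) tie)
    (k : Type*) [Field k] :
    HorizonTree.IsBarcode
      (HorizonTree.sublevelH0 k (HorizonTree.piecewiseLinear τ))
      ((HorizonTree.dualTree (HorizonTree.persistenceWeightedHVG τ r)).hortonPruning.elderRule
        tie) :=
  HorizonTree.isBarcode_elderRule hτ r tie k
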